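/- Let $A$ be an indecomposable affine (generalized) Cartan matrix, $\mathfrak g=\mathfrak g(A)$ the affine Kac--Moody algebra over $\mathbb C$ with Cartan subalgebra $\mathfrak h$ and root spaces $\mathfrak g_\alpha$, let $\Delta(\mathfrak g)\subset\mathfrak h^*\setminus\{0\}$ be its set of roots and $\Phi\subset\Delta(\mathfrak g)$ the set of real roots (twisted types are included). A nonempty subset $\Psi\subseteq\Phi$ is a closed subroot system if $\mathbf s_\alpha(\beta)=\beta-\langle\beta,\alpha^\vee\rangle\alpha\in\Psi$ for all $\alpha,\beta\in\Psi$, and $\alpha+\beta\in\Psi$ whenever $\alpha,\beta\in\Psi$ and $\alpha+\beta\in\Phi$. For such $\Psi$ let $\mathfrak g(\Psi)$ be the Lie subalgebra of $\mathfrak g$ generated by the $\mathfrak g_\alpha$, $\alpha\in\Psi$, and let $\Delta(\Psi)=\{\alpha\in\Delta(\mathfrak g):\mathfrak g_\alpha\cap\mathfrak g(\Psi)\neq0\}$. The regular subalgebras of $\mathfrak g$ are the subalgebras of the form $\mathfrak g(\Psi)$ with $\Psi$ a closed subroot system of $\Phi$. 1. Let $\Psi$ be a closed subroot system of $\Phi$.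 For every $\beta\in\Delta(\Psi)$ there are an irreducible component $\Psi'$ of $\Psi$ (that is, a nonempty subset orthogonal to the rest of $\Psi$ which is not a union of two disjoint nonempty mutually orthogonal subsets) and $\beta_1,\dots,\beta_r\in\Psi'$ such that $\beta=\beta_1+\cdots+\beta_r$ and, for each $1\le i\le r$, $\beta_1+\cdots+\beta_i\in\Delta(\Psi)$, and $\beta_1+\cdots+\beta_i\in\Psi'$ whenever $\beta_1+\cdots+\beta_i\in\Phi$. 2. For every closed subroot system $\Psi$ of $\Phi$, $\Delta(\Psi)\cap\Phi=\Psi$. 3. The map $\Psi\mapsto\mathfrak g(\Psi)$ is a bijection from the set of closed subroot systems of $\Phi$ onto the set of regular subalgebras of $\mathfrak g$. -/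

import Mathlib

noncomputable section

namespace AffineKM

/-- `A` is a generalized Cartan matrix. -/
structure IsGCM {ι : Type*} (A : Matrix ι ι ℤ) : Prop where
  diag : ∀ i, A i i = 2
  nonpos : ∀ i j, i ≠ j → A i j ≤ 0
  zero_symm : ∀ i j, A i j = 0 → A j i = 0

/-- `A` is indecomposable: the index set is not the disjoint union of two nonempty subsets
`s`, `sᶜ` with `A i j = A j i = 0` for all `i ∈ s`, `j ∉ s`. -/
def IsIndecomposable {ι : Type*} (A : Matrix ι ι ℤ) : Prop :=
  ∀ s : Set ι, s.Nonempty → sᶜ.Nonempty → ∃ i ∈ s, ∃ j ∈ sᶜ, A i j ≠ 0 ∨ A j i ≠ 0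

/-- `A` is an indecomposable affine Cartan matrix: an indecomposable generalized Cartan matrix
which becomes a symmetric positive semidefinite matrix of corank one after multiplication by a
diagonal matrix with positive entries. -/
structure IsAffineCartan {ι : Type*} [Fintype ι] (A : Matrix ι ι ℤ) : Prop where
  isGCM : IsGCM A
  indecomposable : IsIndecomposable A
  posSemidef : ∃ d : ι → ℝ, (∀ i, 0 < d i) ∧
    (Matrix.of fun i j => d i * (A i j : ℝ)).PosSemidef
  corank : (A.map (Int.cast : ℤ → ℝ)).rank + 1 = Fintype.card ι

/-- A realization `(H, Π, Π^∨)` of the matrix `A` over `ℂ`: linearly independent simple roots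
in `H^*` and simple coroots in `H` with `⟨α_j, α_i^∨⟩ = A i j`, and
`dim H = 2 n - rank A`. -/
structure Realization {ι : Type*} [Fintype ι] (A : Matrix ι ι ℤ)
    (H : Type*) [AddCommGroup H] [Module ℂ H] where
  simpleRoot : ι → Module.Dual ℂ H
  simpleCoroot : ι → H
  linearIndependent_simpleRoot : LinearIndependent ℂ simpleRoot
  linearIndependent_simpleCoroot : LinearIndependent ℂ simpleCoroot
  pairing : ∀ i j, simpleRoot j (simpleCoroot i) = (A i j : ℂ)
  finiteDimensional : FiniteDimensional ℂ H
  finrank_add_rank : Module.finrank ℂ H + (A.map (Int.cast : ℤ → ℂ)).rank = 2 * Fintype.card ι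

/-- Generators of the Kac--Moody algebra: the elements of `H` and the Chevalley generators. -/
inductive Generators (ι H : Type*)
  | h (x : H) : Generators ι H
  | e (i : ι) : Generators ι H
  | f (i : ι) : Generators ι H

namespace Realization

variable {ι : Type*} [Fintype ι] {A : Matrix ι ι ℤ} {H : Type*} [AddCommGroup H] [Module ℂ H]

/-- The free Lie algebra on the generators. -/
abbrev Free (_R : Realization A H) := FreeLieAlgebra ℂ (Generators ι H)

/-- The generators coming from `H` in the free Lie algebra. -/
abbrev genH (R : Realization A H) (x : H) : R.Free := FreeLieAlgebra.of ℂ (Generators.h x)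
/-- The generators `e_i` in the free Lie algebra. -/
abbrev genE (R : Realization A H) (i : ι) : R.Free := FreeLieAlgebra.of ℂ (Generators.e i)
/-- The generators `f_i` in the free Lie algebra. -/
abbrev genF (R : Realization A H) (i : ι) : R.Free := FreeLieAlgebra.of ℂ (Generators.f i)

/-- The defining relators of the auxiliary algebra `g̃(A)`: `H` is an abelian subalgebra acting on
`e_i`, `f_i` with weights `α_i`, `-α_i`, and `[e_i, f_j] = δ_{ij} α_i^∨`. -/
inductive Relator (R : Realization A H) : R.Free → Prop
  | add (x y : H) : Relator R (R.genH (x + y) - (R.genH x + R.genH y))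
  | smul (c : ℂ) (x : H) : Relator R (R.genH (c • x) - c • R.genH x)
  | hh (x y : H) : Relator R ⁅R.genH x, R.genH y⁆
  | he (x : H) (i : ι) : Relator R (⁅R.genH x, R.genE i⁆ - R.simpleRoot i x • R.genE i)
  | hf (x : H) (i : ι) : Relator R (⁅R.genH x, R.genF i⁆ + R.simpleRoot i x • R.genF i)
  | ef_self (i : ι) : Relator R (⁅R.genE i, R.genF i⁆ - R.genH (R.simpleCoroot i))
  | ef_ne (i j : ι) (hij : i ≠ j) : Relator R ⁅R.genE i, R.genF j⁆

/-- The ideal of the free Lie algebra generated by the relators. -/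
def relatorIdeal (R : Realization A H) : LieIdeal ℂ R.Free :=
  LieSubmodule.lieSpan ℂ R.Free {x | R.Relator x}

/-- The auxiliary Lie algebra `g̃(A)`. -/
abbrev Aux (R : Realization A H) := R.Free ⧸ R.relatorIdeal

/-- The natural map from `H` to `g̃(A)`. -/
def auxH (R : Realization A H) (x : H) : R.Aux :=
  LieSubmodule.Quotient.mk (N := R.relatorIdeal) (R.genH x)

/-- The sum of all ideals of `g̃(A)` which intersect `H` trivially. -/
def radical (R : Realization A H) : LieIdeal ℂ R.Aux :=
  sSup {I : LieIdeal ℂ R.Aux | ∀ x : H, R.auxH x ∈ I → R.auxH x = 0}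

/-- The Kac--Moody algebra `g(A)`: the quotient of `g̃(A)` by the sum of all ideals which intersect
`H` trivially. -/
abbrev KM (R : Realization A H) := R.Aux ⧸ R.radical

/-- The natural map from `H` onto the Cartan subalgebra of `g(A)`. -/
def toKM (R : Realization A H) (x : H) : R.KM :=
  LieSubmodule.Quotient.mk (N := R.radical) (R.auxH x)

/-- The root space `g_α = {x ∈ g | [h, x] = α(h) x for all h ∈ H}`. -/
def rootSpace (R : Realization A H) (α : Module.Dual ℂ H) : Submodule ℂ R.KM where
  carrier := {x | ∀ h : H, ⁅R.toKM h, x⁆ = α h • x}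
  add_mem' {x y} hx hy := fun h => by
    have h1 := hx h
    have h2 := hy h
    rw [lie_add, h1, h2, smul_add]
  zero_mem' := fun h => by rw [lie_zero, smul_zero]
  smul_mem' c x hx := fun h => by
    have h1 := hx h
    rw [lie_smul, h1, smul_comm]

/-- The set `Δ(g)` of roots of `g(A)` with respect to `H`. -/
def roots (R : Realization A H) : Set (Module.Dual ℂ H) :=
  {α | α ≠ 0 ∧ R.rootSpace α ≠ ⊥}

/-- The Weyl group, acting on `H`: the group generated by the simple reflections
`x ↦ x - α_i(x) α_i^∨`. -/
def weylGroup (R : Realization A H) : Subgroup (H ≃ₗ[ℂ] H) :=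
  Subgroup.closure {w | ∃ i, ∀ x, w x = x - R.simpleRoot i x • R.simpleCoroot i}

/-- The set `Φ` of real roots: those roots which are conjugate to a simple root under the Weyl
group. An element `w` of the Weyl group acts on `H^*` by `λ ↦ λ ∘ w⁻¹`. -/
def realRoots (R : Realization A H) : Set (Module.Dual ℂ H) :=
  {α | α ∈ R.roots ∧ ∃ w ∈ R.weylGroup, ∃ i, ∀ x, α (w x) = R.simpleRoot i x}

/-- `x` is the coroot of the real root `α`: if `α = w(α_i)`, then `α^∨ = w(α_i^∨)`. -/
def IsCoroot (R : Realization A H) (α : Module.Dual ℂ H) (x : H) : Prop :=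
  ∃ w ∈ R.weylGroup, ∃ i, (∀ y, α (w y) = R.simpleRoot i y) ∧ x = w (R.simpleCoroot i)

open Classical in
/-- The coroot `α^∨ ∈ H` of a real root `α` (and `0` if `α` is not a real root). -/
def coroot (R : Realization A H) (α : Module.Dual ℂ H) : H :=
  if hα : ∃ x, R.IsCoroot α x then hα.choose else 0

/-- The reflection `s_α(β) = β - ⟨β, α^∨⟩ α`. -/
def reflect (R : Realization A H) (α β : Module.Dual ℂ H) : Module.Dual ℂ H :=
  β - β (R.coroot α) • α

/-- `Ψ` is a closed subroot system of `Φ`. -/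
structure IsClosedSubroot (R : Realization A H) (Ψ : Set (Module.Dual ℂ H)) : Prop where
  subset : Ψ ⊆ R.realRoots
  nonempty : Ψ.Nonempty
  reflect_mem : ∀ α ∈ Ψ, ∀ β ∈ Ψ, R.reflect α β ∈ Ψ
  closed : ∀ α ∈ Ψ, ∀ β ∈ Ψ, α + β ∈ R.realRoots → α + β ∈ Ψ

/-- The subalgebra `g(Ψ)` of `g` generated by the root spaces `g_α`, `α ∈ Ψ`. -/
def regularSubalgebra (R : Realization A H) (Ψ : Set (Module.Dual ℂ H)) :
    LieSubalgebra ℂ R.KM :=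
  LieSubalgebra.lieSpan ℂ R.KM (⋃ α ∈ Ψ, (R.rootSpace α : Set R.KM))

/-- `g'` is a regular subalgebra: `g' = g(Ψ)` for some closed subroot system `Ψ` of `Φ`. -/
def IsRegularSubalgebra (R : Realization A H) (g' : LieSubalgebra ℂ R.KM) : Prop :=
  ∃ Ψ, R.IsClosedSubroot Ψ ∧ g' = R.regularSubalgebra Ψ

/-- The set of roots of a subalgebra `g'` with respect to `H`:
those `α ∈ Δ(g)` with `g_α ∩ g' ≠ 0`. -/
def rootsOf (R : Realization A H) (g' : LieSubalgebra ℂ R.KM) : Set (Module.Dual ℂ H) :=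
  {α | α ∈ R.roots ∧ R.rootSpace α ⊓ g'.toSubmodule ≠ ⊥}

/-- A set of real roots is irreducible if it is nonempty and not the union of two disjoint
nonempty subsets which are orthogonal to each other. -/
def IsIrreducibleSet (R : Realization A H) (C : Set (Module.Dual ℂ H)) : Prop :=
  C.Nonempty ∧ ∀ D ⊆ C, D.Nonempty → (C \ D).Nonempty →
    ∃ α ∈ D, ∃ β ∈ C \ D, β (R.coroot α) ≠ 0

/-- `C` is an irreducible component of `Ψ`: an irreducible subset which is orthogonal to the
rest of `Ψ`. -/
def IsComponent (R : Realization A H) (Ψ C : Set (Module.Dual ℂ H)) : Prop :=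
  C ⊆ Ψ ∧ R.IsIrreducibleSet C ∧ ∀ α ∈ C, ∀ β ∈ Ψ \ C, β (R.coroot α) = 0

end Realization

end AffineKM

end

/-!
The three claims follow from one fact: if a nonzero nested bracket
`[x₁, [x₂, … [xᵣ₋₁, xᵣ]…]]` of root vectors `xᵢ ∈ g_{βᵢ}`, `βᵢ ∈ Ψ`, has a weight which is a real
root, then this weight belongs to `Ψ` (`IsClosedSubroot.sum_mem`). Since such brackets span `g(Ψ)`
and weight spaces are independent, it gives `Δ(Ψ) ∩ Φ = Ψ`, hence the injectivity of `Ψ ↦ g(Ψ)`.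

The fact is proved by adding one generator at a time. The input from the structure of `g` is that
every root of an affine algebra lies in the root lattice and is either real or isotropic for the
positive semidefinite invariant form (`exists_coordinates_of_mem_roots`), and that isotropic lattice
vectors form a group of rank one. If the weight `γ` reached so far is real, it is in `Ψ` by
induction, and closedness applies. If it is isotropic (possibly zero), then `γ = p + q` with
`p, q ∈ Ψ` by induction, and the next bracket is
`[x_β, [x_p, x_q]] = [[x_β, x_p], x_q] + [x_p, [x_β, x_q]]`. One of the two terms, say the first, is
nonzero. Either `β + p` is real and closedness applies twice, or `β + p` is isotropic, and `β`, `p`,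
`q` agree up to signs and integral multiples of a single isotropic vector `δ`. In that case the
integers `j` with `p + j δ ∈ Ψ` are closed under point reflections, and a parity argument yields
`β + p + q ∈ Ψ` (`IsClosedSubroot.translate_mem`).

For the decomposition of a root of `g(Ψ)` one takes the labels of a nonzero nested bracket of that
weight and forgets everything up to the last partial sum which is zero. The labels lie in one
irreducible component, because root vectors attached to different components commute
(`IsClosedSubroot.lie_eq_zero`).

The description of the roots of `g` is the classical one: `g` is spanned by `H` and the nested
brackets of the `e_i` and of the `f_i`; the Serre elements of `g̃(A)` generate ideals meeting `H`
trivially, so `ad e_i` and `ad f_i` are locally nilpotent on `g`; by `sl₂`-theory roots can then be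
reflected, and a positive root of positive norm is brought to a simple root by induction on its
height (`ChevalleyGenerators.exists_conjugate_of_form_pos`). Exchanging the `e_i` and the `f_i`
reduces negative roots to positive ones.
-/

noncomputable section

/-! ### Iterated brackets and generated subalgebras -/

namespace AffineKM

section LieGenerators

variable {L : Type*} [LieRing L] [LieAlgebra ℂ L]

/-- `NestedBracket P [k₁, …, kᵣ] z` means that `z = [x₁, [x₂, … [xᵣ₋₁, xᵣ]…]]` where `xᵢ` is a
generator with label `kᵢ`, that is, `P kᵢ xᵢ` holds. -/
inductive NestedBracket {κ : Type*} (P : κ → L → Prop) : List κ → L → Prop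
  | single {k : κ} {x : L} : P k x → NestedBracket P [k] x
  | cons {k : κ} {x : L} {l : List κ} {y : L} :
      P k x → NestedBracket P l y → NestedBracket P (k :: l) ⁅x, y⁆

theorem lie_mem_of_mem_lieSpan {G : Set L} {S : Submodule ℂ L}
    (hS : ∀ g ∈ G, ∀ s ∈ S, ⁅g, s⁆ ∈ S) {x : L} (hx : x ∈ LieSubalgebra.lieSpan ℂ L G) :
    ∀ s ∈ S, ⁅x, s⁆ ∈ S := by
  induction hx using LieSubalgebra.lieSpan_induction with
  | mem x hx => exact hS x hx
  | zero => intro s _; simp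
  | smul c x _ ih => intro s hs; rw [smul_lie]; exact S.smul_mem _ (ih s hs)
  | add x y _ _ ihx ihy => intro s hs; rw [add_lie]; exact S.add_mem (ihx s hs) (ihy s hs)
  | lie x y _ _ ihx ihy =>
    intro s hs
    rw [lie_lie]
    exact S.sub_mem (ihx _ (ihy s hs)) (ihy _ (ihx s hs))

/-- A subspace which is stable under the adjoint action of a set of generators and contains
these generators is everything. -/
theorem eq_top_of_lie_mem {G : Set L} (hG : LieSubalgebra.lieSpan ℂ L G = ⊤) {S : Submodule ℂ L}
    (hGS : G ⊆ S) (hS : ∀ g ∈ G, ∀ s ∈ S, ⁅g, s⁆ ∈ S) : S = ⊤ := by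
  have key : ∀ x : L, ∀ s ∈ S, ⁅x, s⁆ ∈ S := fun x =>
    lie_mem_of_mem_lieSpan hS (x := x) (by rw [hG]; trivial)
  let K : LieSubalgebra ℂ L := { S with lie_mem' := fun {x y} _ hy => key x y hy }
  have hK : LieSubalgebra.lieSpan ℂ L G ≤ K := LieSubalgebra.lieSpan_le.2 hGS
  rw [hG] at hK
  exact eq_top_iff.2 fun x _ => hK (LieSubalgebra.mem_top x)

theorem NestedBracket.mem_lieSpan {κ : Type*} {P : κ → L → Prop} {l : List κ} {z : L}
    (h : NestedBracket P l z) : z ∈ LieSubalgebra.lieSpan ℂ L {x | ∃ k, P k x} := by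
  induction h with
  | single h => exact LieSubalgebra.subset_lieSpan ⟨_, h⟩
  | cons h _ ih => exact LieSubalgebra.lie_mem _ (LieSubalgebra.subset_lieSpan ⟨_, h⟩) ih

/-- The subalgebra generated by a set is spanned by the nested brackets of its elements. -/
theorem mem_span_nestedBracket {κ : Type*} {P : κ → L → Prop} {x : L}
    (hx : x ∈ LieSubalgebra.lieSpan ℂ L {x | ∃ k, P k x}) :
    x ∈ Submodule.span ℂ {z | ∃ l, NestedBracket P l z} := by
  set S := Submodule.span ℂ {z : L | ∃ l, NestedBracket P l z} with hS
  have hstab : ∀ g ∈ {x : L | ∃ k, P k x}, ∀ s ∈ S, ⁅g, s⁆ ∈ S := by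
    rintro g ⟨k, hk⟩ s hs
    induction hs using Submodule.span_induction with
    | mem z hz =>
      obtain ⟨l, hl⟩ := hz
      exact Submodule.subset_span ⟨_, hl.cons hk⟩
    | zero => simp
    | add y z _ _ hy hz => rw [lie_add]; exact S.add_mem hy hz
    | smul c y _ hy => rw [lie_smul]; exact S.smul_mem _ hy
  have hle : ∀ y ∈ S, y ∈ LieSubalgebra.lieSpan ℂ L {x : L | ∃ k, P k x} := by
    intro y hy
    have : S ≤ (LieSubalgebra.lieSpan ℂ L {x : L | ∃ k, P k x}).toSubmodule := by
      rw [hS, Submodule.span_le]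
      rintro z ⟨l, hl⟩
      exact hl.mem_lieSpan
    exact this hy
  let K : LieSubalgebra ℂ L :=
    { S with lie_mem' := fun {y z} hy hz => lie_mem_of_mem_lieSpan hstab (hle y hy) z hz }
  have hK : LieSubalgebra.lieSpan ℂ L {x : L | ∃ k, P k x} ≤ K := by
    rw [LieSubalgebra.lieSpan_le]
    rintro y ⟨k, hk⟩
    exact Submodule.subset_span ⟨[k], .single hk⟩
  exact hK hx

end LieGenerators

/-! ### Weight spaces -/

section Weights

variable {L : Type*} [LieRing L] [LieAlgebra ℂ L] {H : Type*} [AddCommGroup H] [Module ℂ H]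

/-- The space of vectors of weight `α` in `L`, for an abelian algebra `H` acting through a linear
map `h : H → L`. -/
def weightSpace (h : H →ₗ[ℂ] L) (α : Module.Dual ℂ H) : Submodule ℂ L where
  carrier := {x | ∀ y : H, ⁅h y, x⁆ = α y • x}
  add_mem' {x y} hx hy := fun z => by rw [lie_add, hx z, hy z, smul_add]
  zero_mem' := fun z => by rw [lie_zero, smul_zero]
  smul_mem' c x hx := fun z => by rw [lie_smul, hx z, smul_comm]

theorem mem_weightSpace {h : H →ₗ[ℂ] L} {α : Module.Dual ℂ H} {x : L} :
    x ∈ weightSpace h α ↔ ∀ y : H, ⁅h y, x⁆ = α y • x := Iff.rfl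

theorem lie_mem_weightSpace {h : H →ₗ[ℂ] L} {α β : Module.Dual ℂ H} {x y : L}
    (hx : x ∈ weightSpace h α) (hy : y ∈ weightSpace h β) : ⁅x, y⁆ ∈ weightSpace h (α + β) := by
  intro z
  rw [leibniz_lie, hx z, hy z, smul_lie, lie_smul, ← add_smul, LinearMap.add_apply]

theorem weightSpace_neg (h : H →ₗ[ℂ] L) (α : Module.Dual ℂ H) :
    weightSpace (-h) α = weightSpace h (-α) := by
  ext x
  simp only [mem_weightSpace, LinearMap.neg_apply, neg_lie, neg_smul]
  exact forall_congr' fun y => neg_eq_iff_eq_neg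

theorem weight_unique {h : H →ₗ[ℂ] L} {α β : Module.Dual ℂ H} {x : L} (hx0 : x ≠ 0)
    (hα : x ∈ weightSpace h α) (hβ : x ∈ weightSpace h β) : α = β := by
  ext y
  have := (hα y).symm.trans (hβ y)
  exact smul_left_injective ℂ hx0 this

theorem iSupIndep_weightSpace {h : H →ₗ[ℂ] L} (hcomm : ∀ x y, ⁅h x, h y⁆ = 0) :
    iSupIndep (weightSpace h) := by
  have hc : ∀ i j, Commute (LieAlgebra.ad ℂ L (h i)) (LieAlgebra.ad ℂ L (h j)) := by
    intro i j
    ext x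
    simp only [Module.End.mul_apply, LieAlgebra.ad_apply]
    rw [leibniz_lie, hcomm, zero_lie, zero_add]
  have := Module.End.independent_iInf_maxGenEigenspace_of_forall_mapsTo
    (fun y => LieAlgebra.ad ℂ L (h y))
    (fun i j φ => Module.End.mapsTo_maxGenEigenspace_of_comm (hc j i) φ)
  refine (this.comp (f := fun α : Module.Dual ℂ H => (α : H → ℂ)) DFunLike.coe_injective).mono ?_
  intro α x hx
  rw [Function.comp_apply, Submodule.mem_iInf]
  intro y
  refine Module.End.mem_maxGenEigenspace _ _ _ |>.2 ⟨1, ?_⟩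
  simp [hx y]

/-- A nonzero weight vector lying in the span of a set of weight vectors has the same weight as
some nonzero element of that set. -/
theorem exists_mem_weightSpace_of_mem_span {h : H →ₗ[ℂ] L} (hcomm : ∀ x y, ⁅h x, h y⁆ = 0)
    {S : Set L} (hS : ∀ s ∈ S, ∃ β, s ∈ weightSpace h β) {α : Module.Dual ℂ H} {x : L}
    (hx0 : x ≠ 0) (hx : x ∈ weightSpace h α) (hxS : x ∈ Submodule.span ℂ S) :
    ∃ s ∈ S, s ≠ 0 ∧ s ∈ weightSpace h α := by
  by_contra! hcon
  have hle : Submodule.span ℂ S ≤ ⨆ β, ⨆ (_ : β ≠ α), weightSpace h β := by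
    rw [Submodule.span_le]
    intro s hs
    by_cases hs0 : s = 0
    · rw [hs0]; exact Submodule.zero_mem _
    · obtain ⟨β, hβ⟩ := hS s hs
      have hne : β ≠ α := by
        rintro rfl
        exact hcon s hs hs0 hβ
      exact (le_iSup₂_of_le (f := fun β (_ : β ≠ α) => weightSpace h β) β hne le_rfl) hβ
  exact hx0 (Submodule.disjoint_def.1 (iSupIndep_weightSpace hcomm α) x hx (hle hxS))

end Weights

end AffineKM

/-! ### The invariant form on the root lattice -/

namespace AffineKM

section Form

variable {ι : Type*} [Fintype ι] {A : Matrix ι ι ℤ}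

/-- Positive numbers `d i` such that the matrix `(d i * A i j)` is symmetric positive
semidefinite. -/
def IsAffineCartan.scale (hA : IsAffineCartan A) : ι → ℝ := hA.posSemidef.choose

theorem IsAffineCartan.scale_pos (hA : IsAffineCartan A) (i : ι) : 0 < hA.scale i :=
  hA.posSemidef.choose_spec.1 i

theorem IsAffineCartan.scale_posSemidef (hA : IsAffineCartan A) :
    (Matrix.of fun i j => hA.scale i * (A i j : ℝ)).PosSemidef :=
  hA.posSemidef.choose_spec.2

theorem IsAffineCartan.scale_mul_comm (hA : IsAffineCartan A) (i j : ι) :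
    hA.scale i * (A i j : ℝ) = hA.scale j * (A j i : ℝ) := by
  have := hA.scale_posSemidef.isHermitian.apply i j
  simpa using this.symm

/-- The symmetric positive semidefinite form on the root lattice, whose elements are represented by
their integral coordinates with respect to the simple roots. -/
def IsAffineCartan.form (hA : IsAffineCartan A) :
    (ι → ℤ) →ₗ[ℤ] (ι → ℤ) →ₗ[ℤ] ℝ :=
  LinearMap.mk₂ ℤ (fun c c' => ∑ i, (c i : ℝ) * (hA.scale i * ((A.mulVec c' i : ℤ) : ℝ)))
    (fun c₁ c₂ c' => by simp [add_mul, Finset.sum_add_distrib])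
    (fun n c c' => by simp [Finset.mul_sum, mul_assoc])
    (fun c c₁ c₂ => by simp [Matrix.mulVec_add, mul_add, Finset.sum_add_distrib])
    (fun n c c' => by
      simp only [Matrix.mulVec_smul, Pi.smul_apply, smul_eq_mul, Int.cast_mul]
      rw [zsmul_eq_mul, Finset.mul_sum]
      exact Finset.sum_congr rfl fun i _ => by ring)

theorem IsAffineCartan.form_apply (hA : IsAffineCartan A) (c c' : ι → ℤ) :
    hA.form c c' = ∑ i, (c i : ℝ) * (hA.scale i * ((A.mulVec c' i : ℤ) : ℝ)) := rfl

theorem IsAffineCartan.form_comm (hA : IsAffineCartan A) (c c' : ι → ℤ) :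
    hA.form c c' = hA.form c' c := by
  simp only [hA.form_apply, Matrix.mulVec, dotProduct, Int.cast_sum, Int.cast_mul, Finset.mul_sum]
  rw [Finset.sum_comm]
  refine Finset.sum_congr rfl fun j _ => Finset.sum_congr rfl fun i _ => ?_
  rw [← mul_assoc (hA.scale i), hA.scale_mul_comm]
  ring

theorem IsAffineCartan.form_single_left [DecidableEq ι] (hA : IsAffineCartan A) (i : ι)
    (c : ι → ℤ) : hA.form (Pi.single i 1) c = hA.scale i * ((A.mulVec c i : ℤ) : ℝ) := by
  rw [hA.form_apply, Finset.sum_eq_single i]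
  · simp
  · intro j _ hj
    simp [hj]
  · simp

theorem IsAffineCartan.form_single_self [DecidableEq ι] (hA : IsAffineCartan A) (i : ι) :
    hA.form (Pi.single i 1) (Pi.single i 1) = 2 * hA.scale i := by
  rw [hA.form_single_left]
  simp [hA.isGCM.diag, mul_comm]

theorem IsAffineCartan.form_self_eq_dotProduct (hA : IsAffineCartan A) (c : ι → ℤ) :
    hA.form c c = star (fun i => (c i : ℝ)) ⬝ᵥ
      Matrix.mulVec (Matrix.of fun i j => hA.scale i * (A i j : ℝ)) (fun i => (c i : ℝ)) := by
  simp [hA.form_apply, Matrix.mulVec, dotProduct, Finset.mul_sum, mul_assoc]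

theorem IsAffineCartan.form_self_nonneg (hA : IsAffineCartan A) (c : ι → ℤ) :
    0 ≤ hA.form c c := by
  rw [hA.form_self_eq_dotProduct]
  exact hA.scale_posSemidef.dotProduct_mulVec_nonneg _

/-- An isotropic vector of the positive semidefinite form lies in the kernel of `A`. -/
theorem IsAffineCartan.mulVec_eq_zero (hA : IsAffineCartan A) {c : ι → ℤ}
    (hc : hA.form c c = 0) : A.mulVec c = 0 := by
  rw [hA.form_self_eq_dotProduct, hA.scale_posSemidef.dotProduct_mulVec_zero_iff] at hc
  ext i
  have h := congrFun hc i
  simp only [Matrix.mulVec, dotProduct, Matrix.of_apply, mul_assoc, ← Finset.mul_sum,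
    Pi.zero_apply, mul_eq_zero, (hA.scale_pos i).ne', false_or] at h
  simpa [Matrix.mulVec, dotProduct] using (by exact_mod_cast h : ∑ j, A i j * c j = 0)

theorem IsAffineCartan.form_isotropic_right (hA : IsAffineCartan A) {c : ι → ℤ}
    (hc : hA.form c c = 0) (c' : ι → ℤ) : hA.form c' c = 0 := by
  simp [hA.form_apply, hA.mulVec_eq_zero hc]

theorem IsAffineCartan.form_isotropic_left (hA : IsAffineCartan A) {c : ι → ℤ}
    (hc : hA.form c c = 0) (c' : ι → ℤ) : hA.form c c' = 0 := by
  rw [hA.form_comm, hA.form_isotropic_right hc]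

/-- Since `A` has corank one, two isotropic vectors of the root lattice are coprime multiples of a
third one. -/
theorem IsAffineCartan.exists_coprime_multiples (hA : IsAffineCartan A) {u v : ι → ℤ}
    (hu : hA.form u u = 0) (hv : hA.form v v = 0) :
    ∃ (δ : ι → ℤ) (a b : ℤ), IsCoprime a b ∧ u = a • δ ∧ v = b • δ := by
  by_cases hu0 : u = 0
  · exact ⟨v, 0, 1, isCoprime_zero_left.2 isUnit_one, by simp [hu0], by simp⟩
  set B := (A.map (Int.cast : ℤ → ℝ)).mulVecLin with hB
  have hmem : ∀ c : ι → ℤ, hA.form c c = 0 → (fun i => (c i : ℝ)) ∈ LinearMap.ker B := by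
    intro c hc
    rw [LinearMap.mem_ker, hB, Matrix.mulVecLin_apply]
    ext i
    have h := congrFun (hA.mulVec_eq_zero hc) i
    simp only [Matrix.mulVec, dotProduct, Pi.zero_apply, Matrix.map_apply] at h ⊢
    exact_mod_cast h
  have hdim : Module.finrank ℝ (LinearMap.ker B) = 1 := by
    have h1 := LinearMap.finrank_range_add_finrank_ker B
    have h2 : Module.finrank ℝ (LinearMap.range B) + 1 = Fintype.card ι := hA.corank
    rw [Module.finrank_fintype_fun_eq_card] at h1
    omega
  obtain ⟨i, hi⟩ := Function.ne_iff.1 hu0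
  have hune : (⟨_, hmem u hu⟩ : LinearMap.ker B) ≠ 0 := by
    intro h
    have := congrFun (congrArg Subtype.val h) i
    exact hi (by simpa using this)
  obtain ⟨t, ht⟩ := (finrank_eq_one_iff_of_nonzero' _ hune).1 hdim ⟨_, hmem v hv⟩
  have ht' : ∀ j, t * (u j : ℝ) = v j := fun j => by
    simpa using congrFun (congrArg Subtype.val ht) j
  have hprop : ∀ j, v i * u j = u i * v j := by
    intro j
    have : (v i : ℝ) * u j = u i * v j := by rw [← ht' i, ← ht' j]; ring
    exact_mod_cast this
  have hg : 0 < Int.gcd (u i) (v i) := Int.gcd_pos_of_ne_zero_left _ hi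
  obtain ⟨a, b, hcop, ha, hb⟩ := Int.exists_gcd_one hg
  have hab : IsCoprime a b := Int.isCoprime_iff_gcd_eq_one.2 hcop
  have hprop' : ∀ j, b * u j = a * v j := by
    intro j
    have hg' : ((Int.gcd (u i) (v i) : ℕ) : ℤ) ≠ 0 := by exact_mod_cast hg.ne'
    exact mul_right_cancel₀ hg' (by linear_combination hprop j - u j * hb + v j * ha)
  obtain ⟨p, q, hpq⟩ := hab
  refine ⟨p • u + q • v, a, b, ⟨p, q, hpq⟩, ?_, ?_⟩
  · ext j
    simp only [Pi.smul_apply, Pi.add_apply, smul_eq_mul]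
    linear_combination (-u j) * hpq + q * hprop' j
  · ext j
    simp only [Pi.smul_apply, Pi.add_apply, smul_eq_mul]
    linear_combination (-v j) * hpq - p * hprop' j

end Form

/-! ### Real roots and the Weyl group -/

namespace Realization

variable {ι : Type*} [Fintype ι] {A : Matrix ι ι ℤ} {H : Type*} [AddCommGroup H] [Module ℂ H]

/-- The embedding of the root lattice in `H^*`: the weight with coordinates `c` is
`∑ i, c i • α_i`. -/
def latticeWeight (R : Realization A H) : (ι → ℤ) →ₗ[ℤ] Module.Dual ℂ H :=
  Fintype.linearCombination ℤ R.simpleRoot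

theorem latticeWeight_apply (R : Realization A H) (c : ι → ℤ) :
    R.latticeWeight c = ∑ i, c i • R.simpleRoot i := rfl

theorem latticeWeight_single [DecidableEq ι] (R : Realization A H) (i : ι) :
    R.latticeWeight (Pi.single i 1) = R.simpleRoot i := by
  simp [latticeWeight]

theorem latticeWeight_injective (R : Realization A H) : Function.Injective R.latticeWeight := by
  rw [← LinearMap.ker_eq_bot, LinearMap.ker_eq_bot']
  intro c hc
  have h := Fintype.linearIndependent_iff.1 R.linearIndependent_simpleRoot (fun i => (c i : ℂ))
    (by simpa [latticeWeight_apply, Int.cast_smul_eq_zsmul] using hc)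
  ext i
  exact_mod_cast h i

theorem latticeWeight_simpleCoroot (R : Realization A H) (c : ι → ℤ) (i : ι) :
    R.latticeWeight c (R.simpleCoroot i) = ((A.mulVec c i : ℤ) : ℂ) := by
  simp [latticeWeight_apply, R.pairing, Matrix.mulVec, dotProduct, mul_comm]

theorem simpleRoot_simpleCoroot_self (R : Realization A H) (hA : IsGCM A) (i : ι) :
    R.simpleRoot i (R.simpleCoroot i) = 2 := by
  rw [R.pairing, hA.diag]; norm_num

/-- The simple reflection acting on `H`. -/
def simpleReflection (R : Realization A H) (hA : IsGCM A) (i : ι) : H ≃ₗ[ℂ] H :=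
  Module.reflection (R.simpleRoot_simpleCoroot_self hA i)

theorem simpleReflection_apply (R : Realization A H) (hA : IsGCM A) (i : ι) (y : H) :
    R.simpleReflection hA i y = y - R.simpleRoot i y • R.simpleCoroot i :=
  Module.reflection_apply _ _

theorem simpleReflection_mem (R : Realization A H) (hA : IsGCM A) (i : ι) :
    R.simpleReflection hA i ∈ R.weylGroup :=
  Subgroup.subset_closure ⟨i, R.simpleReflection_apply hA i⟩

/-- The simple reflection acting on the coordinates of the elements of the root lattice. -/
def latticeReflection [DecidableEq ι] (hA : IsGCM A) (i : ι) : (ι → ℤ) ≃ₗ[ℤ] (ι → ℤ) :=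
  Module.reflection (f := (LinearMap.proj i).comp A.mulVecLin) (x := Pi.single i 1)
    (by simp [hA.diag])

theorem latticeReflection_apply [DecidableEq ι] (hA : IsGCM A) (i : ι) (c : ι → ℤ) :
    latticeReflection hA i c = c - A.mulVec c i • Pi.single i 1 :=
  Module.reflection_apply _ _

theorem latticeWeight_latticeReflection [DecidableEq ι] (R : Realization A H) (hA : IsGCM A)
    (i : ι) (c : ι → ℤ) (y : H) :
    R.latticeWeight (latticeReflection hA i c) y =
      R.latticeWeight c (y - R.simpleRoot i y • R.simpleCoroot i) := by
  rw [latticeReflection_apply, map_sub, map_smul, latticeWeight_single, map_sub, map_smul,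
    latticeWeight_simpleCoroot]
  simp [mul_comm]

theorem form_latticeReflection [DecidableEq ι] (hA : IsAffineCartan A) (i : ι) (c c' : ι → ℤ) :
    hA.form (latticeReflection hA.isGCM i c) (latticeReflection hA.isGCM i c') = hA.form c c' := by
  simp only [latticeReflection_apply, map_sub, map_smul, LinearMap.sub_apply, LinearMap.smul_apply,
    hA.form_single_self, hA.form_comm c (Pi.single i 1), hA.form_single_left]
  simp only [zsmul_eq_mul]
  ring

/-- The action of a Weyl group element on the root lattice is isometric. -/
theorem exists_lattice_isometry (R : Realization A H) (hA : IsAffineCartan A) {w : H ≃ₗ[ℂ] H}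
    (hw : w ∈ R.weylGroup) :
    ∃ g : (ι → ℤ) ≃ₗ[ℤ] (ι → ℤ), (∀ c y, R.latticeWeight c (w y) = R.latticeWeight (g c) y) ∧
      ∀ c c', hA.form (g c) (g c') = hA.form c c' := by
  classical
  induction hw using Subgroup.closure_induction with
  | mem w hw =>
    obtain ⟨i, hi⟩ := hw
    refine ⟨latticeReflection hA.isGCM i, fun c y => ?_, form_latticeReflection hA i⟩
    rw [hi, R.latticeWeight_latticeReflection]
  | one => exact ⟨LinearEquiv.refl ℤ _, fun _ _ => rfl, fun _ _ => rfl⟩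
  | mul w₁ w₂ _ _ h₁ h₂ =>
    obtain ⟨g₁, h₁, h₁'⟩ := h₁
    obtain ⟨g₂, h₂, h₂'⟩ := h₂
    refine ⟨g₁.trans g₂, fun c y => ?_, fun c c' => ?_⟩
    · rw [LinearEquiv.mul_apply, h₁, h₂]; rfl
    · exact (h₂' _ _).trans (h₁' _ _)
  | inv w _ h =>
    obtain ⟨g, h, h'⟩ := h
    refine ⟨g.symm, fun c y => ?_, fun c c' => ?_⟩
    · have := h (g.symm c) (w⁻¹ y)
      rw [LinearEquiv.apply_symm_apply] at this
      rw [← this, ← LinearEquiv.mul_apply, mul_inv_cancel]; rfl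
    · rw [← h', LinearEquiv.apply_symm_apply, LinearEquiv.apply_symm_apply]

/-- A real root `α` has positive norm, and the pairing with `α^∨` is `2 (·, α) / (α, α)`. In
particular it does not depend on the presentation of `α` as a conjugate of a simple root. -/
theorem exists_coordinates_of_mem_realRoots (R : Realization A H) (hA : IsAffineCartan A)
    {α : Module.Dual ℂ H} (hα : α ∈ R.realRoots) :
    ∃ c, α = R.latticeWeight c ∧ 0 < hA.form c c ∧
      ∀ c', ∃ n : ℤ, R.latticeWeight c' (R.coroot α) = n ∧
        n * hA.form c c = 2 * hA.form c c' := by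
  classical
  obtain ⟨-, w₀, hw₀, i₀, h₀⟩ := hα
  have hex : ∃ x, R.IsCoroot α x := ⟨_, w₀, hw₀, i₀, h₀, rfl⟩
  have hspec : R.IsCoroot α (R.coroot α) := by
    rw [coroot, dif_pos hex]; exact hex.choose_spec
  obtain ⟨w, hw, i, hwi, hx⟩ := hspec
  obtain ⟨g, hg, hg'⟩ := R.exists_lattice_isometry hA hw
  have hnorm : hA.form (g.symm (Pi.single i 1)) (g.symm (Pi.single i 1)) = 2 * hA.scale i := by
    rw [← hg', LinearEquiv.apply_symm_apply, hA.form_single_self]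
  refine ⟨g.symm (Pi.single i 1), ?_, ?_, fun c' => ⟨A.mulVec (g c') i, ?_, ?_⟩⟩
  · ext y
    obtain ⟨y, rfl⟩ := w.surjective y
    rw [hwi, hg, LinearEquiv.apply_symm_apply, latticeWeight_single]
  · rw [hnorm]; linarith [hA.scale_pos i]
  · rw [hx, hg, latticeWeight_simpleCoroot]
  · rw [hnorm, ← hg' (g.symm (Pi.single i 1)) c', LinearEquiv.apply_symm_apply,
      hA.form_single_left]
    ring

end Realization

end AffineKM

/-! ### Lie algebras with Chevalley generators -/

namespace AffineKM

variable {ι : Type*} [Fintype ι] {A : Matrix ι ι ℤ} {H : Type*} [AddCommGroup H] [Module ℂ H]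

/-- A Lie algebra generated by an image of `H` and elements `e i`, `f i` satisfying the relations
of the auxiliary algebra `g̃(A)`. -/
structure ChevalleyGenerators (R : Realization A H) (L : Type*) [LieRing L] [LieAlgebra ℂ L] where
  h : H →ₗ[ℂ] L
  e : ι → L
  f : ι → L
  lie_h_h : ∀ x y, ⁅h x, h y⁆ = 0
  lie_h_e : ∀ x i, ⁅h x, e i⁆ = R.simpleRoot i x • e i
  lie_h_f : ∀ x i, ⁅h x, f i⁆ = -(R.simpleRoot i x • f i)
  lie_e_f_self : ∀ i, ⁅e i, f i⁆ = h (R.simpleCoroot i)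
  lie_e_f_ne : ∀ i j, i ≠ j → ⁅e i, f j⁆ = 0
  lieSpan_eq_top :
    LieSubalgebra.lieSpan ℂ L (Set.range h ∪ (Set.range e ∪ Set.range f)) = ⊤

namespace ChevalleyGenerators

open Realization

variable {R : Realization A H} {L : Type*} [LieRing L] [LieAlgebra ℂ L]

theorem range_neg_linearMap (h : H →ₗ[ℂ] L) : Set.range (-h) = Set.range h := by
  ext x
  exact ⟨fun ⟨y, hy⟩ => ⟨-y, by simpa using hy⟩, fun ⟨y, hy⟩ => ⟨-y, by simpa using hy⟩⟩

/-- The generators obtained by exchanging the roles of the `e i` and the `f i`. The map from `H`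
changes its sign, so that the new `e i` has weight `α_i` again. -/
def swap (G : ChevalleyGenerators R L) : ChevalleyGenerators R L where
  h := -G.h
  e := G.f
  f := G.e
  lie_h_h x y := by simp [G.lie_h_h]
  lie_h_e x i := by simp [G.lie_h_f]
  lie_h_f x i := by simp [G.lie_h_e]
  lie_e_f_self i := by rw [← lie_skew, G.lie_e_f_self]; rfl
  lie_e_f_ne i j hij := by rw [← lie_skew, G.lie_e_f_ne j i hij.symm, neg_zero]
  lieSpan_eq_top := by
    rw [range_neg_linearMap, Set.union_comm (Set.range G.f), G.lieSpan_eq_top]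

/-- The image of Chevalley generators under a surjective homomorphism. -/
def map {L' : Type*} [LieRing L'] [LieAlgebra ℂ L'] (G : ChevalleyGenerators R L)
    (φ : L →ₗ⁅ℂ⁆ L') (hφ : Function.Surjective φ) : ChevalleyGenerators R L' where
  h := (φ : L →ₗ[ℂ] L').comp G.h
  e i := φ (G.e i)
  f i := φ (G.f i)
  lie_h_h x y := by simp [← LieHom.map_lie, G.lie_h_h]
  lie_h_e x i := by simp [← LieHom.map_lie, G.lie_h_e]
  lie_h_f x i := by simp [← LieHom.map_lie, G.lie_h_f]
  lie_e_f_self i := by simp [← LieHom.map_lie, G.lie_e_f_self]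
  lie_e_f_ne i j hij := by simp [← LieHom.map_lie, G.lie_e_f_ne i j hij]
  lieSpan_eq_top := by
    have h1 := LieSubalgebra.map_lieSpan (R := ℂ) (f := φ)
      (s := Set.range G.h ∪ (Set.range G.e ∪ Set.range G.f))
    rw [G.lieSpan_eq_top, Set.image_union, Set.image_union, ← Set.range_comp, ← Set.range_comp,
      ← Set.range_comp] at h1
    refine Eq.trans h1.symm (eq_top_iff.2 fun x _ => ?_)
    obtain ⟨y, rfl⟩ := hφ x
    exact (LieSubalgebra.mem_map _ _ _).2 ⟨y, LieSubalgebra.mem_top y, rfl⟩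

variable (G : ChevalleyGenerators R L)

theorem e_mem_weightSpace (i : ι) : G.e i ∈ weightSpace G.h (R.simpleRoot i) :=
  fun y => G.lie_h_e y i

theorem f_mem_weightSpace (i : ι) : G.f i ∈ weightSpace G.h (-R.simpleRoot i) :=
  fun y => by rw [G.lie_h_f, LinearMap.neg_apply, neg_smul]

theorem h_mem_weightSpace (y : H) : G.h y ∈ weightSpace G.h 0 :=
  fun z => by simp [G.lie_h_h]

/-- `G.IsPositive l z`: the element `z` is the nested bracket of the `e i`, where `i` runs through
the list `l` in order. Nested brackets of the `f i` are described by `G.swap.IsPositive`. -/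
abbrev IsPositive : List ι → L → Prop := NestedBracket fun i x => x = G.e i

section Content

variable [DecidableEq ι]

/-- The coordinates of the sum of the simple roots `α_i`, where `i` runs through the list `l`. -/
def content (l : List ι) : ι → ℤ := (l.map fun i => Pi.single i 1).sum

omit [Fintype ι] in
theorem content_apply (l : List ι) (i : ι) : content l i = l.count i := by
  induction l with
  | nil => simp [content]
  | cons j l ih =>
    have : content (j :: l) = Pi.single j 1 + content l := by simp [content]
    rw [this, Pi.add_apply, ih, List.count_cons]
    by_cases hij : j = i
    · subst hij; simp; ring
    · simp [hij, Ne.symm hij]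

variable {G} in
theorem IsPositive.mem_weightSpace {l : List ι} {z : L} (hz : G.IsPositive l z) :
    z ∈ weightSpace G.h (R.latticeWeight (content l)) := by
  induction hz with
  | single hx =>
    rw [hx]
    simpa [content, R.latticeWeight_single] using G.e_mem_weightSpace _
  | cons hx _ ih =>
    rw [hx]
    simpa [content, R.latticeWeight_single] using lie_mem_weightSpace (G.e_mem_weightSpace _) ih

end Content

variable {G} in
/-- A nested bracket involving only one of the `e i` is `e i` itself or zero. -/
theorem IsPositive.length_eq_one {l : List ι} {z : L} (hz : G.IsPositive l z) {i : ι}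
    (hl : ∀ j ∈ l, j = i) (hz0 : z ≠ 0) : z = G.e i ∧ l = [i] := by
  induction hz with
  | @single k x hx =>
    obtain rfl : k = i := hl _ (by simp)
    exact ⟨hx, rfl⟩
  | @cons k x l y hx hy ih =>
    have hy0 : y ≠ 0 := by rintro rfl; simp at hz0
    obtain ⟨rfl, -⟩ := ih (fun j hj => hl j (List.mem_cons_of_mem _ hj)) hy0
    rw [hx, hl k (by simp)] at hz0
    simp at hz0

/-- A set spanning the Lie algebra: the image of `H`, the nested brackets of the `e i` and those of
the `f i`. -/
def spanningSet : Set L :=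
  Set.range G.h ∪ ({z | ∃ l, G.IsPositive l z} ∪ {z | ∃ l, G.swap.IsPositive l z})

theorem swap_spanningSet : G.swap.spanningSet = G.spanningSet := by
  have h1 : Set.range G.swap.h = Set.range G.h := range_neg_linearMap G.h
  unfold spanningSet
  rw [h1, Set.union_comm {z | ∃ l, G.swap.IsPositive l z}]
  rfl

theorem exists_weight_of_mem_spanningSet {s : L} (hs : s ∈ G.spanningSet) :
    ∃ β, s ∈ weightSpace G.h β := by
  classical
  rcases hs with ⟨y, rfl⟩ | ⟨l, hl⟩ | ⟨l, hl⟩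
  · exact ⟨_, G.h_mem_weightSpace y⟩
  · exact ⟨_, hl.mem_weightSpace⟩
  · exact ⟨_, (weightSpace_neg G.h _).le hl.mem_weightSpace⟩

theorem lie_e_mem_of_swap_isPositive (i : ι) {l : List ι} {z : L} (hz : G.swap.IsPositive l z) :
    ⁅G.e i, z⁆ ∈ Submodule.span ℂ (Set.range G.h ∪ {z | ∃ l, G.swap.IsPositive l z}) := by
  set S := Submodule.span ℂ (Set.range G.h ∪ {z | ∃ l, G.swap.IsPositive l z}) with hS
  have hef : ∀ j, ∃ y, ⁅G.e i, G.f j⁆ = G.h y := by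
    intro j
    by_cases hij : i = j
    · subst hij; exact ⟨_, G.lie_e_f_self i⟩
    · exact ⟨0, by rw [G.lie_e_f_ne i j hij, map_zero]⟩
  have hf : ∀ j, ∀ s ∈ S, ⁅G.f j, s⁆ ∈ S := by
    intro j s hs
    induction hs using Submodule.span_induction with
    | mem s hs =>
      rcases hs with ⟨y, rfl⟩ | ⟨l, hl⟩
      · rw [← lie_skew, G.lie_h_f, neg_neg]
        exact S.smul_mem _ (Submodule.subset_span (Or.inr ⟨[j], .single rfl⟩))
      · exact Submodule.subset_span (Or.inr ⟨_, .cons rfl hl⟩)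
    | zero => simp
    | add x y _ _ hx hy => rw [lie_add]; exact S.add_mem hx hy
    | smul c x _ hx => rw [lie_smul]; exact S.smul_mem _ hx
  induction hz with
  | @single j x hx =>
    obtain ⟨y, hy⟩ := hef j
    rw [hx]
    change ⁅G.e i, G.f j⁆ ∈ S
    rw [hy]
    exact Submodule.subset_span (Or.inl ⟨y, rfl⟩)
  | @cons j x l z hx hz ih =>
    classical
    obtain ⟨y, hy⟩ := hef j
    rw [hx]
    change ⁅G.e i, ⁅G.f j, z⁆⁆ ∈ S
    rw [leibniz_lie, hy, (weightSpace_neg G.h _).le (IsPositive.mem_weightSpace hz) y]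
    exact S.add_mem (S.smul_mem _ (Submodule.subset_span (Or.inr ⟨_, hz⟩))) (hf j _ ih)

theorem lie_e_mem_span_spanningSet (i : ι) {s : L} (hs : s ∈ Submodule.span ℂ G.spanningSet) :
    ⁅G.e i, s⁆ ∈ Submodule.span ℂ G.spanningSet := by
  induction hs using Submodule.span_induction with
  | mem s hs =>
    rcases hs with ⟨y, rfl⟩ | ⟨l, hl⟩ | ⟨l, hl⟩
    · rw [← lie_skew, G.lie_h_e]
      exact Submodule.neg_mem _ (Submodule.smul_mem _ _
        (Submodule.subset_span (Or.inr (Or.inl ⟨[i], .single rfl⟩))))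
    · exact Submodule.subset_span (Or.inr (Or.inl ⟨_, .cons rfl hl⟩))
    · exact Submodule.span_mono (Set.union_subset_union_right _ Set.subset_union_right)
        (G.lie_e_mem_of_swap_isPositive i hl)
  | zero => simp
  | add x y _ _ hx hy => rw [lie_add]; exact Submodule.add_mem _ hx hy
  | smul c x _ hx => rw [lie_smul]; exact Submodule.smul_mem _ _ hx

/-- The weak triangular decomposition. -/
theorem span_spanningSet : Submodule.span ℂ G.spanningSet = ⊤ := by
  refine eq_top_of_lie_mem G.lieSpan_eq_top ?_ ?_
  · rintro _ (⟨y, rfl⟩ | ⟨i, rfl⟩ | ⟨i, rfl⟩)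
    · exact Submodule.subset_span (Or.inl ⟨y, rfl⟩)
    · exact Submodule.subset_span (Or.inr (Or.inl ⟨[i], .single rfl⟩))
    · exact Submodule.subset_span (Or.inr (Or.inr ⟨[i], .single rfl⟩))
  · rintro _ (⟨y, rfl⟩ | ⟨i, rfl⟩ | ⟨i, rfl⟩) s hs
    · induction hs using Submodule.span_induction with
      | mem s hs =>
        obtain ⟨β, hβ⟩ := G.exists_weight_of_mem_spanningSet hs
        rw [hβ y]
        exact Submodule.smul_mem _ _ (Submodule.subset_span hs)
      | zero => simp
      | add x y _ _ hx hy => rw [lie_add]; exact Submodule.add_mem _ hx hy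
      | smul c x _ hx => rw [lie_smul]; exact Submodule.smul_mem _ _ hx
    · exact G.lie_e_mem_span_spanningSet i hs
    · rw [← swap_spanningSet] at hs ⊢
      exact G.swap.lie_e_mem_span_spanningSet i hs

/-- Every nonzero weight is, up to sign, the weight of a nonzero nested bracket of simple root
vectors. -/
theorem exists_isPositive_of_weight [DecidableEq ι] {α : Module.Dual ℂ H} (hα : α ≠ 0) {x : L}
    (hx0 : x ≠ 0) (hx : x ∈ weightSpace G.h α) :
    ∃ l z, z ≠ 0 ∧ ((G.IsPositive l z ∧ α = R.latticeWeight (content l)) ∨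
      (G.swap.IsPositive l z ∧ α = -R.latticeWeight (content l))) := by
  obtain ⟨s, hs, hs0, hsα⟩ := exists_mem_weightSpace_of_mem_span G.lie_h_h
    (fun s hs => G.exists_weight_of_mem_spanningSet hs) hx0 hx
    (by rw [G.span_spanningSet]; trivial)
  rcases hs with ⟨y, rfl⟩ | ⟨l, hl⟩ | ⟨l, hl⟩
  · exact absurd (weight_unique hs0 hsα (G.h_mem_weightSpace y)) hα
  · exact ⟨l, s, hs0, Or.inl ⟨hl, weight_unique hs0 hsα hl.mem_weightSpace⟩⟩
  · exact ⟨l, s, hs0, Or.inr ⟨hl, weight_unique hs0 hsα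
      ((weightSpace_neg G.h _).le hl.mem_weightSpace)⟩⟩

/-! ### Serre relations and integrability -/

/-- The elements obtained from `θ` by repeated brackets with the `e i`. -/
inductive RaisedFrom (θ : L) : L → Prop
  | base : RaisedFrom θ θ
  | step (i : ι) {x : L} : RaisedFrom θ x → RaisedFrom θ ⁅G.e i, x⁆

/-- A vector of positive weight which is annihilated by all `f i` generates an ideal which meets the
image of `H` trivially: the ideal is spanned by vectors of positive weight. -/
theorem exists_lieIdeal_of_lie_f_eq_zero {θ : L} {c : ι → ℤ} (hc : 0 ≤ c) (hc0 : c ≠ 0)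
    (hθ : θ ∈ weightSpace G.h (R.latticeWeight c)) (hf : ∀ i, ⁅G.f i, θ⁆ = 0) :
    ∃ I : LieIdeal ℂ L, θ ∈ I ∧ ∀ y, G.h y ∈ I → G.h y = 0 := by
  classical
  set T := {x | G.RaisedFrom θ x}
  set S := Submodule.span ℂ T
  have hw : ∀ x ∈ T, ∃ c : ι → ℤ, 0 ≤ c ∧ c ≠ 0 ∧ x ∈ weightSpace G.h (R.latticeWeight c) := by
    intro x hx
    induction hx with
    | base => exact ⟨c, hc, hc0, hθ⟩
    | @step i x _ ih =>
      obtain ⟨c, hc, hc0, hx⟩ := ih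
      have hs : (0 : ι → ℤ) ≤ Pi.single i 1 := Pi.single_nonneg.2 zero_le_one
      refine ⟨Pi.single i 1 + c, add_nonneg hs hc, ?_, ?_⟩
      · intro h0
        have : c ≤ 0 := h0 ▸ le_add_of_nonneg_left hs
        exact hc0 (le_antisymm this hc)
      · rw [map_add, R.latticeWeight_single]
        exact lie_mem_weightSpace (G.e_mem_weightSpace i) hx
  have hfT : ∀ x ∈ T, ∀ j, ⁅G.f j, x⁆ ∈ S := by
    intro x hx
    induction hx with
    | base => intro j; rw [hf]; exact S.zero_mem
    | @step i x hx ih =>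
      intro j
      obtain ⟨c', -, -, hxw⟩ := hw x hx
      have hstep : ∀ s ∈ S, ⁅G.e i, s⁆ ∈ S := by
        intro s hs
        induction hs using Submodule.span_induction with
        | mem s hs => exact Submodule.subset_span (RaisedFrom.step i hs)
        | zero => simp
        | add x y _ _ hx hy => rw [lie_add]; exact S.add_mem hx hy
        | smul c x _ hx => rw [lie_smul]; exact S.smul_mem _ hx
      rw [leibniz_lie]
      refine S.add_mem ?_ (hstep _ (ih j))
      by_cases hij : i = j
      · subst hij
        rw [← lie_skew (G.f i), G.lie_e_f_self, neg_lie, hxw]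
        exact S.neg_mem (S.smul_mem _ (Submodule.subset_span hx))
      · rw [← lie_skew (G.f j), G.lie_e_f_ne i j hij, neg_zero, zero_lie]
        exact S.zero_mem
  have hstab : ∀ g ∈ Set.range G.h ∪ (Set.range G.e ∪ Set.range G.f), ∀ s ∈ S, ⁅g, s⁆ ∈ S := by
    intro g hg s hs
    induction hs using Submodule.span_induction with
    | mem s hs =>
      rcases hg with ⟨y, rfl⟩ | ⟨i, rfl⟩ | ⟨i, rfl⟩
      · obtain ⟨c', -, -, hsw⟩ := hw s hs
        rw [hsw]
        exact S.smul_mem _ (Submodule.subset_span hs)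
      · exact Submodule.subset_span (RaisedFrom.step i hs)
      · exact hfT s hs i
    | zero => simp
    | add x y _ _ hx hy => rw [lie_add]; exact S.add_mem hx hy
    | smul c x _ hx => rw [lie_smul]; exact S.smul_mem _ hx
  refine ⟨{ S with
    lie_mem := fun {x m} hm => lie_mem_of_mem_lieSpan hstab (x := x)
      (by rw [G.lieSpan_eq_top]; trivial) m hm }, Submodule.subset_span .base, ?_⟩
  intro y hy
  by_contra hy0
  obtain ⟨s, hs, hs0, hsw⟩ := exists_mem_weightSpace_of_mem_span G.lie_h_h
    (fun s hs => let ⟨c', _, _, h⟩ := hw s hs; ⟨_, h⟩) hy0 (G.h_mem_weightSpace y) hy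
  obtain ⟨c', -, hc', hs'⟩ := hw s hs
  have h0 := weight_unique hs0 hs' hsw
  rw [← map_zero R.latticeWeight] at h0
  exact hc' (R.latticeWeight_injective h0)

/-- If `α_i^∨ ≠ 0` in `L`, then `(α_i^∨, e_i, f_i)` is an `sl₂`-triple. -/
theorem isSl2Triple (hA : IsGCM A) {i : ι} (hi : G.h (R.simpleCoroot i) ≠ 0) :
    IsSl2Triple (G.h (R.simpleCoroot i)) (G.e i) (G.f i) where
  h_ne_zero := hi
  lie_e_f := G.lie_e_f_self i
  lie_h_e_nsmul := by
    rw [G.lie_h_e, R.simpleRoot_simpleCoroot_self hA, two_smul, two_nsmul]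
  lie_h_f_nsmul := by
    rw [G.lie_h_f, R.simpleRoot_simpleCoroot_self hA, two_smul, two_nsmul]

theorem e_eq_zero_of_h_eq_zero (hA : IsGCM A) {i : ι} (hi : G.h (R.simpleCoroot i) = 0) :
    G.e i = 0 := by
  have := G.lie_h_e (R.simpleCoroot i) i
  rw [hi, zero_lie, R.simpleRoot_simpleCoroot_self hA] at this
  simpa using this.symm

/-- The Serre element `(ad e_i)^(1 - A i j) e_j`. -/
def serreElement (i j : ι) : L :=
  ((LieAlgebra.ad ℂ L (G.e i)) ^ ((-A i j).toNat + 1)) (G.e j)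

theorem serreElement_mem_weightSpace [DecidableEq ι] (i j : ι) :
    G.serreElement i j ∈ weightSpace G.h
      (R.latticeWeight (((-A i j).toNat + 1) • Pi.single i 1 + Pi.single j 1)) := by
  rw [serreElement]
  induction (-A i j).toNat + 1 with
  | zero => simpa [R.latticeWeight_single] using G.e_mem_weightSpace j
  | succ n ih =>
    rw [pow_succ', Module.End.mul_apply, succ_nsmul', add_assoc, map_add, R.latticeWeight_single]
    exact lie_mem_weightSpace (G.e_mem_weightSpace i) ih

theorem lie_f_serreElement (hA : IsGCM A) {i j : ι} (hij : i ≠ j) (k : ι) :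
    ⁅G.f k, G.serreElement i j⁆ = 0 := by
  have hskew : ∀ a b, a ≠ b → ⁅G.f b, G.e a⁆ = 0 := fun a b hab => by
    rw [← lie_skew, G.lie_e_f_ne a b hab, neg_zero]
  by_cases hki : i = k
  · subst hki
    by_cases hi : G.h (R.simpleCoroot i) = 0
    · rw [serreElement, pow_succ', G.e_eq_zero_of_h_eq_zero hA hi]
      simp
    by_cases hj : G.e j = 0
    · rw [serreElement, hj]; simp
    -- `e_j` is a primitive vector of weight `-A i j` for the `sl₂`-triple `(-α_i^∨, f_i, e_i)`.
    have t := (G.isSl2Triple hA hi).symm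
    have hnn : ((-A i j).toNat : ℤ) = -A i j :=
      Int.toNat_of_nonneg (by linarith [hA.nonpos i j hij])
    have hnn' : (((-A i j).toNat : ℕ) : ℂ) = -(A i j : ℂ) := by
      exact_mod_cast congrArg (Int.cast : ℤ → ℂ) hnn
    have P : t.HasPrimitiveVectorWith (G.e j) (((-A i j).toNat : ℕ) : ℂ) :=
      { ne_zero := hj
        lie_h := by rw [neg_lie, G.lie_h_e, R.pairing, hnn', neg_smul]
        lie_e := hskew j i hij.symm }
    have := P.lie_e_pow_succ_toEnd_f (-A i j).toNat
    rw [sub_self, mul_zero, zero_smul] at this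
    exact this
  · have hcomm : ∀ (n : ℕ) (x : L), ⁅G.f k, ((LieAlgebra.ad ℂ L (G.e i)) ^ n) x⁆ =
        ((LieAlgebra.ad ℂ L (G.e i)) ^ n) ⁅G.f k, x⁆ := by
      intro n x
      induction n with
      | zero => simp
      | succ n ih =>
        rw [pow_succ', Module.End.mul_apply, Module.End.mul_apply, LieAlgebra.ad_apply,
          LieAlgebra.ad_apply, leibniz_lie, hskew i k hki, zero_lie, zero_add, ih]
    rw [serreElement, hcomm]
    by_cases hkj : j = k
    · subst hkj
      have h1 : ⁅G.e i, ⁅G.f j, G.e j⁆⁆ = (A j i : ℂ) • G.e i := by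
        rw [← lie_skew (G.f j), G.lie_e_f_self, lie_neg, lie_skew, G.lie_h_e, R.pairing]
      rw [pow_succ, Module.End.mul_apply, LieAlgebra.ad_apply, h1, map_smul]
      rcases Nat.eq_zero_or_pos (-A i j).toNat with h0 | hpos
      · have : A i j = 0 := by have := hA.nonpos i j hij; omega
        rw [hA.zero_symm i j this]
        simp
      · obtain ⟨m, hm⟩ := Nat.exists_eq_succ_of_ne_zero hpos.ne'
        rw [hm, pow_succ]
        simp
    · rw [hskew j k hkj, map_zero]

/-- Serre elements lie in ideals meeting the image of `H` trivially. -/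
theorem exists_lieIdeal_serreElement_mem (hA : IsGCM A) {i j : ι} (hij : i ≠ j) :
    ∃ I : LieIdeal ℂ L, G.serreElement i j ∈ I ∧ ∀ y, G.h y ∈ I → G.h y = 0 := by
  classical
  have hs : ∀ i : ι, (0 : ι → ℤ) ≤ Pi.single i 1 := fun i => Pi.single_nonneg.2 zero_le_one
  refine G.exists_lieIdeal_of_lie_f_eq_zero (add_nonneg (nsmul_nonneg (hs i) _) (hs j)) ?_
    (G.serreElement_mem_weightSpace i j) (G.lie_f_serreElement hA hij)
  intro h
  have := congrFun h j
  simp [hij.symm] at this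

/-- If the Serre elements vanish, then `ad e_i` is locally nilpotent. -/
theorem exists_ad_pow_eq_zero (hS : ∀ i j, i ≠ j → G.serreElement i j = 0) (i : ι) (x : L) :
    ∃ n : ℕ, ((LieAlgebra.ad ℂ L (G.e i)) ^ n) x = 0 := by
  have hle : LieSubalgebra.lieSpan ℂ L (Set.range G.h ∪ (Set.range G.e ∪ Set.range G.f)) ≤
      LieSubalgebra.engel ℂ (G.e i) := by
    have hh : ∀ y, ((LieAlgebra.ad ℂ L (G.e i)) ^ 2) (G.h y) = 0 := by
      intro y
      rw [pow_two, Module.End.mul_apply, LieAlgebra.ad_apply, LieAlgebra.ad_apply,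
        ← lie_skew (G.e i) (G.h y), G.lie_h_e]
      simp
    rw [LieSubalgebra.lieSpan_le]
    rintro _ (⟨y, rfl⟩ | ⟨j, rfl⟩ | ⟨j, rfl⟩) <;>
      rw [SetLike.mem_coe, LieSubalgebra.mem_engel_iff]
    · exact ⟨2, hh y⟩
    · by_cases hij : i = j
      · subst hij; exact ⟨1, by simp⟩
      · exact ⟨_, hS i j hij⟩
    · by_cases hij : i = j
      · subst hij
        refine ⟨3, ?_⟩
        rw [pow_succ, Module.End.mul_apply, LieAlgebra.ad_apply, G.lie_e_f_self, hh]
      · exact ⟨1, by simp [G.lie_e_f_ne i j hij]⟩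
  rw [G.lieSpan_eq_top] at hle
  exact (LieSubalgebra.mem_engel_iff ℂ _ _).1 (hle (LieSubalgebra.mem_top x))

/-- A weight whose pairing with `α_i^∨` is a natural number can be reflected. -/
theorem exists_mem_weightSpace_reflection (hA : IsGCM A)
    (hS : ∀ i j, i ≠ j → G.serreElement i j = 0) {α : Module.Dual ℂ H} {x : L} (hx0 : x ≠ 0)
    (hx : x ∈ weightSpace G.h α) {i : ι} {k : ℕ} (hk : α (R.simpleCoroot i) = k) :
    ∃ y ≠ 0, y ∈ weightSpace G.h (α - k • R.simpleRoot i) := by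
  by_cases hi : G.h (R.simpleCoroot i) = 0
  · have := hx (R.simpleCoroot i)
    rw [hi, zero_lie, hk] at this
    have hk0 : k = 0 := by
      have := (smul_eq_zero.1 this.symm).resolve_right hx0
      exact_mod_cast this
    exact ⟨x, hx0, by simpa [hk0] using hx⟩
  -- The highest vector of the `e_i`-string through `x` is primitive of weight `k + 2 n`.
  have hex := G.exists_ad_pow_eq_zero hS i x
  classical
  obtain ⟨n, hn⟩ : ∃ n, Nat.find hex = n + 1 := by
    refine Nat.exists_eq_succ_of_ne_zero fun h0 => ?_
    have := Nat.find_spec hex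
    rw [h0] at this
    exact hx0 (by simpa using this)
  have hmem : ∀ m : ℕ, ((LieAlgebra.ad ℂ L (G.e i)) ^ m) x ∈
      weightSpace G.h (α + m • R.simpleRoot i) := by
    intro m
    induction m with
    | zero => simpa using hx
    | succ m ih =>
      rw [pow_succ', Module.End.mul_apply]
      have := lie_mem_weightSpace (G.e_mem_weightSpace i) ih
      rwa [add_left_comm, ← succ_nsmul'] at this
  set y := ((LieAlgebra.ad ℂ L (G.e i)) ^ n) x with hy
  have t := G.isSl2Triple hA hi
  have hval : (α + n • R.simpleRoot i) (R.simpleCoroot i) = ((k + 2 * n : ℕ) : ℂ) := by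
    rw [LinearMap.add_apply, LinearMap.smul_apply, hk, R.simpleRoot_simpleCoroot_self hA]
    push_cast
    rw [nsmul_eq_mul]; ring
  have P : t.HasPrimitiveVectorWith y ((k + 2 * n : ℕ) : ℂ) :=
    { ne_zero := Nat.find_min hex (by omega)
      lie_h := by rw [hmem n, hval]
      lie_e := by
        have := Nat.find_spec hex
        rwa [hn, pow_succ'] at this }
  refine ⟨((LieModule.toEnd ℂ L L (G.f i)) ^ (n + k)) y, ?_, ?_⟩
  · exact P.pow_toEnd_f_ne_zero_of_eq_nat rfl (by omega)
  · have hf : ∀ m : ℕ, ((LieModule.toEnd ℂ L L (G.f i)) ^ m) y ∈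
        weightSpace G.h (α + n • R.simpleRoot i - m • R.simpleRoot i) := by
      intro m
      induction m with
      | zero => simpa using hmem n
      | succ m ih =>
        rw [pow_succ', Module.End.mul_apply]
        have := lie_mem_weightSpace (G.f_mem_weightSpace i) ih
        rwa [show -R.simpleRoot i + (α + n • R.simpleRoot i - m • R.simpleRoot i) =
          α + n • R.simpleRoot i - (m + 1) • R.simpleRoot i by module] at this
    have := hf (n + k)
    rwa [show α + n • R.simpleRoot i - (n + k) • R.simpleRoot i = α - k • R.simpleRoot i by
      module] at this

/-- A positive weight of positive norm is conjugate to a simple root, by induction on a bound `N`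
of its height: positivity of the norm provides a simple root in its support which pairs positively
with it, and the corresponding reflection decreases the height. -/
theorem exists_conjugate_of_form_pos (hA : IsAffineCartan A)
    (hS : ∀ i j, i ≠ j → G.serreElement i j = 0) (N : ℕ) :
    ∀ c : ι → ℤ, 0 ≤ c → ∑ i, c i < N → 0 < hA.form c c →
      (∃ x ≠ 0, x ∈ weightSpace G.h (R.latticeWeight c)) →
      ∃ w ∈ R.weylGroup, ∃ i, ∀ y, R.latticeWeight c (w y) = R.simpleRoot i y := by
  classical
  induction N with
  | zero =>
    intro c hc hN
    exact absurd hN (not_lt.2 (by simpa using Finset.sum_nonneg fun i _ => hc i))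
  | succ N ih =>
    rintro c hc hN hpos ⟨x, hx0, hx⟩
    obtain ⟨i, -, hi⟩ : ∃ i ∈ Finset.univ,
        0 < (c i : ℝ) * (hA.scale i * ((A.mulVec c i : ℤ) : ℝ)) := by
      by_contra! hcon
      rw [hA.form_apply] at hpos
      exact absurd hpos (not_lt.2 (Finset.sum_nonpos hcon))
    have hci : 0 ≤ (c i : ℝ) := by exact_mod_cast hc i
    have hAi : 0 < A.mulVec c i := by
      have h1 := pos_of_mul_pos_right hi hci
      have h2 := pos_of_mul_pos_right h1 (hA.scale_pos i).le
      exact_mod_cast h2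
    -- A weight with one positive coordinate is the weight of a nested bracket of the `e i`.
    have hsign : ∀ {c' : ι → ℤ} {x' : L}, (∃ j, 0 < c' j) → x' ≠ 0 →
        x' ∈ weightSpace G.h (R.latticeWeight c') →
        ∃ l z, z ≠ 0 ∧ G.IsPositive l z ∧ c' = content l := by
      rintro c' x' ⟨j, hj⟩ hx'0 hx'
      have hne : R.latticeWeight c' ≠ 0 := by
        intro h0
        rw [← map_zero R.latticeWeight] at h0
        rw [R.latticeWeight_injective h0] at hj
        exact lt_irrefl _ hj
      obtain ⟨l, z, hz0, ⟨hl, hw⟩ | ⟨hl, hw⟩⟩ := G.exists_isPositive_of_weight hne hx'0 hx'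
      · exact ⟨l, z, hz0, hl, R.latticeWeight_injective hw⟩
      · rw [← map_neg] at hw
        rw [R.latticeWeight_injective hw, Pi.neg_apply, content_apply] at hj
        omega
    -- Either the weight is a multiple of `α_i`, or its reflection is still positive.
    by_cases hsupp : ∀ j, j ≠ i → c j = 0
    · have hci' : 0 < c i := by
        refine lt_of_le_of_ne (hc i) fun h0 => ?_
        rw [← h0] at hi
        simp at hi
      obtain ⟨l, z, hz0, hl, hcl⟩ := hsign ⟨i, hci'⟩ hx0 hx
      have hall : ∀ j ∈ l, j = i := by
        intro j hj
        by_contra hji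
        have := hsupp j hji
        rw [hcl, content_apply] at this
        exact (List.count_pos_iff.2 hj).ne' (by exact_mod_cast this)
      obtain ⟨-, rfl⟩ := hl.length_eq_one hall hz0
      refine ⟨1, Subgroup.one_mem _, i, fun y => ?_⟩
      rw [hcl, show content [i] = Pi.single i 1 by simp [content], R.latticeWeight_single]
      rfl
    · push Not at hsupp
      obtain ⟨j, hji, hcj⟩ := hsupp
      obtain ⟨k, hk⟩ := Int.eq_ofNat_of_zero_le hAi.le
      obtain ⟨y, hy0, hy⟩ := G.exists_mem_weightSpace_reflection hA.isGCM hS hx0 hx (i := i)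
        (k := k) (by rw [R.latticeWeight_simpleCoroot, hk]; simp)
      set c' := latticeReflection hA.isGCM i c with hc'
      have hc'_apply : c' = c - (k : ℤ) • Pi.single i 1 := by rw [hc', latticeReflection_apply, hk]
      have hy' : y ∈ weightSpace G.h (R.latticeWeight c') := by
        rwa [hc'_apply, map_sub, map_smul, R.latticeWeight_single, natCast_zsmul]
      have hc'j : 0 < c' j := by
        have : c' j = c j := by simp [hc'_apply, hji]
        rw [this]
        exact lt_of_le_of_ne (hc j) hcj.symm
      obtain ⟨l, z, -, -, hcl⟩ := hsign ⟨j, hc'j⟩ hy0 hy'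
      have hc'nonneg : 0 ≤ c' := by
        intro m
        rw [hcl, content_apply]
        exact Int.natCast_nonneg _
      have hsum : ∑ m, c' m < N := by
        have : ∑ m, c' m = ∑ m, c m - k := by
          simp [hc'_apply, Finset.sum_sub_distrib, ← Finset.mul_sum]
        push_cast at hN
        omega
      obtain ⟨w, hw, m, hm⟩ := ih c' hc'nonneg hsum
        (by rw [hc', form_latticeReflection]; exact hpos) ⟨y, hy0, hy'⟩
      refine ⟨R.simpleReflection hA.isGCM i * w,
        Subgroup.mul_mem _ (R.simpleReflection_mem hA.isGCM i) hw, m, fun y => ?_⟩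
      rw [LinearEquiv.mul_apply, R.simpleReflection_apply,
        ← R.latticeWeight_latticeReflection hA.isGCM, ← hc', hm]

end ChevalleyGenerators

end AffineKM

/-! ### The Chevalley generators of the Kac--Moody algebra -/

namespace AffineKM

/-- The quotient map by a Lie ideal as a homomorphism of Lie algebras. -/
def quotientHom {L : Type*} [LieRing L] [LieAlgebra ℂ L] (I : LieIdeal ℂ L) : L →ₗ⁅ℂ⁆ L ⧸ I :=
  { (LieSubmodule.Quotient.mk' I : L →ₗ[ℂ] L ⧸ I) with
    map_lie' := fun {x y} => LieSubmodule.Quotient.mk_bracket (I := I) x y }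

theorem quotientHom_surjective {L : Type*} [LieRing L] [LieAlgebra ℂ L] (I : LieIdeal ℂ L) :
    Function.Surjective (quotientHom I) := LieSubmodule.Quotient.surjective_mk' I

theorem quotientHom_eq_zero {L : Type*} [LieRing L] [LieAlgebra ℂ L] {I : LieIdeal ℂ L} {x : L} :
    quotientHom I x = 0 ↔ x ∈ I := LieSubmodule.Quotient.mk_eq_zero'

theorem lieSpan_range_freeLieAlgebra_of (X : Type*) :
    LieSubalgebra.lieSpan ℂ (FreeLieAlgebra ℂ X) (Set.range (FreeLieAlgebra.of ℂ)) = ⊤ := by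
  set K := LieSubalgebra.lieSpan ℂ (FreeLieAlgebra ℂ X) (Set.range (FreeLieAlgebra.of ℂ))
  let F : FreeLieAlgebra ℂ X →ₗ⁅ℂ⁆ K :=
    FreeLieAlgebra.lift ℂ fun x => ⟨_, LieSubalgebra.subset_lieSpan ⟨x, rfl⟩⟩
  have hF : K.incl.comp F = LieHom.id := by
    ext x
    simp [F]
  refine eq_top_iff.2 fun x _ => ?_
  have := LieHom.congr_fun hF x
  rw [LieHom.comp_apply, LieHom.id_apply] at this
  rw [← this]
  exact (F x).2

namespace Realization

variable {ι : Type*} [Fintype ι] {A : Matrix ι ι ℤ} {H : Type*} [AddCommGroup H] [Module ℂ H]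

theorem quotientHom_relator (R : Realization A H) {x : R.Free} (hx : R.Relator x) :
    quotientHom R.relatorIdeal x = 0 :=
  quotientHom_eq_zero.2 (LieSubmodule.subset_lieSpan hx)

/-- The generators of the auxiliary algebra `g̃(A)`. -/
def auxGenerators (R : Realization A H) : ChevalleyGenerators R R.Aux where
  h :=
    { toFun := R.auxH
      map_add' := fun x y => by
        have := R.quotientHom_relator (.add x y)
        rw [map_sub, map_add, sub_eq_zero] at this
        exact this
      map_smul' := fun c x => by
        have := R.quotientHom_relator (.smul c x)
        rw [map_sub, map_smul, sub_eq_zero] at this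
        exact this }
  e i := quotientHom R.relatorIdeal (R.genE i)
  f i := quotientHom R.relatorIdeal (R.genF i)
  lie_h_h x y := by
    have := R.quotientHom_relator (.hh x y)
    rwa [LieHom.map_lie] at this
  lie_h_e x i := by
    have := R.quotientHom_relator (.he x i)
    rwa [map_sub, map_smul, sub_eq_zero, LieHom.map_lie] at this
  lie_h_f x i := by
    have := R.quotientHom_relator (.hf x i)
    rwa [map_add, map_smul, add_eq_zero_iff_eq_neg, LieHom.map_lie] at this
  lie_e_f_self i := by
    have := R.quotientHom_relator (.ef_self i)
    rwa [map_sub, sub_eq_zero, LieHom.map_lie] at this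
  lie_e_f_ne i j hij := by
    have := R.quotientHom_relator (.ef_ne i j hij)
    rwa [LieHom.map_lie] at this
  lieSpan_eq_top := by
    have h1 := LieSubalgebra.map_lieSpan (R := ℂ) (f := quotientHom R.relatorIdeal)
      (s := Set.range (FreeLieAlgebra.of ℂ))
    rw [lieSpan_range_freeLieAlgebra_of] at h1
    refine eq_top_iff.2 fun x _ => ?_
    obtain ⟨y, rfl⟩ := quotientHom_surjective _ x
    have hy : quotientHom R.relatorIdeal y ∈ LieSubalgebra.map (quotientHom R.relatorIdeal) ⊤ :=
      (LieSubalgebra.mem_map _ _ _).2 ⟨y, LieSubalgebra.mem_top y, rfl⟩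
    rw [h1] at hy
    refine LieSubalgebra.lieSpan_mono ?_ hy
    rintro _ ⟨_, ⟨g, rfl⟩, rfl⟩
    rcases g with y | i | i
    · exact Or.inl ⟨y, rfl⟩
    · exact Or.inr (Or.inl ⟨i, rfl⟩)
    · exact Or.inr (Or.inr ⟨i, rfl⟩)

/-- The generators of the Kac--Moody algebra `g(A)`. -/
def kmGenerators (R : Realization A H) : ChevalleyGenerators R R.KM :=
  R.auxGenerators.map (quotientHom R.radical) (quotientHom_surjective _)

theorem mem_rootSpace (R : Realization A H) {α : Module.Dual ℂ H} {x : R.KM} :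
    x ∈ R.rootSpace α ↔ x ∈ weightSpace R.kmGenerators.h α := Iff.rfl

theorem _root_.AffineKM.ChevalleyGenerators.serreElement_map {R : Realization A H} {L L' : Type*}
    [LieRing L] [LieAlgebra ℂ L] [LieRing L'] [LieAlgebra ℂ L'] (G : ChevalleyGenerators R L)
    (φ : L →ₗ⁅ℂ⁆ L') (hφ : Function.Surjective φ) (i j : ι) :
    (G.map φ hφ).serreElement i j = φ (G.serreElement i j) := by
  have : ∀ (n : ℕ) (x : L), ((LieAlgebra.ad ℂ L' (φ (G.e i))) ^ n) (φ x) =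
      φ (((LieAlgebra.ad ℂ L (G.e i)) ^ n) x) := by
    intro n x
    induction n with
    | zero => simp
    | succ n ih =>
      rw [pow_succ', Module.End.mul_apply, ih, pow_succ', Module.End.mul_apply]
      simp
  exact this _ _

theorem kmGenerators_serreElement (R : Realization A H) (hA : IsGCM A) {i j : ι} (hij : i ≠ j) :
    R.kmGenerators.serreElement i j = 0 := by
  obtain ⟨I, hI, hIh⟩ := R.auxGenerators.exists_lieIdeal_serreElement_mem hA hij
  rw [kmGenerators, ChevalleyGenerators.serreElement_map, quotientHom_eq_zero]
  exact (le_sSup (a := I) hIh : I ≤ R.radical) hI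

theorem kmGenerators_swap_serreElement (R : Realization A H) (hA : IsGCM A) {i j : ι}
    (hij : i ≠ j) : R.kmGenerators.swap.serreElement i j = 0 := by
  obtain ⟨I, hI, hIh⟩ := R.auxGenerators.swap.exists_lieIdeal_serreElement_mem hA hij
  have h1 := R.auxGenerators.swap.serreElement_map (quotientHom R.radical)
    (quotientHom_surjective _) i j
  refine Eq.trans (show R.kmGenerators.swap.serreElement i j = _ from rfl) (h1.trans ?_)
  rw [quotientHom_eq_zero]
  have hle : I ≤ R.radical := by
    refine le_sSup fun x hx => ?_
    have h2 := hIh x (I.neg_mem hx)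
    exact neg_eq_zero.1 h2
  exact hle hI

/-! ### The roots of an affine Kac--Moody algebra -/

/-- Every root lies in the root lattice and is a real root or isotropic. -/
theorem exists_coordinates_of_mem_roots (R : Realization A H) (hA : IsAffineCartan A)
    {α : Module.Dual ℂ H} (hα : α ∈ R.roots) :
    ∃ c, α = R.latticeWeight c ∧ (α ∈ R.realRoots ∨ hA.form c c = 0) := by
  classical
  obtain ⟨hα0, hαx⟩ := id hα
  obtain ⟨x, hx, hx0⟩ := (Submodule.ne_bot_iff _).1 hαx
  have hcontent : ∀ l : List ι, 0 ≤ ChevalleyGenerators.content l := fun l i => by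
    rw [ChevalleyGenerators.content_apply]; exact Int.natCast_nonneg _
  obtain ⟨l, z, hz0, ⟨hl, hw⟩ | ⟨hl, hw⟩⟩ := R.kmGenerators.exists_isPositive_of_weight hα0 hx0 hx
  · refine ⟨_, hw, ?_⟩
    rcases (hA.form_self_nonneg (ChevalleyGenerators.content l)).eq_or_lt with h0 | hpos
    · exact Or.inr h0.symm
    obtain ⟨w, hw', i, hi⟩ := R.kmGenerators.exists_conjugate_of_form_pos hA
      (fun i j hij => R.kmGenerators_serreElement hA.isGCM hij)
      ((∑ i, ChevalleyGenerators.content l i).toNat + 1) _ (hcontent l) (by omega) hpos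
      ⟨x, hx0, hw ▸ hx⟩
    exact Or.inl ⟨hα, w, hw', i, fun y => by rw [hw, hi]⟩
  · refine ⟨-ChevalleyGenerators.content l, by rw [hw, map_neg], ?_⟩
    rcases (hA.form_self_nonneg (ChevalleyGenerators.content l)).eq_or_lt with h0 | hpos
    · exact Or.inr (by simpa using h0.symm)
    obtain ⟨w, hw', i, hi⟩ := R.kmGenerators.swap.exists_conjugate_of_form_pos hA
      (fun i j hij => R.kmGenerators_swap_serreElement hA.isGCM hij)
      ((∑ i, ChevalleyGenerators.content l i).toNat + 1) _ (hcontent l) (by omega) hpos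
      ⟨x, hx0, (weightSpace_neg R.kmGenerators.h _).ge (hw ▸ hx)⟩
    refine Or.inl ⟨hα, w * R.simpleReflection hA.isGCM i,
      Subgroup.mul_mem _ hw' (R.simpleReflection_mem hA.isGCM i), i, fun y => ?_⟩
    rw [hw, LinearEquiv.mul_apply, LinearMap.neg_apply, hi, R.simpleReflection_apply, map_sub,
      map_smul, R.simpleRoot_simpleCoroot_self hA.isGCM, smul_eq_mul]
    ring

/-- The weight of a nonzero root vector, which may be zero, is a real root or isotropic. -/
theorem mem_realRoots_or_isotropic (R : Realization A H) (hA : IsAffineCartan A) {c : ι → ℤ}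
    {z : R.KM} (hz : z ∈ R.rootSpace (R.latticeWeight c)) (hz0 : z ≠ 0) :
    R.latticeWeight c ∈ R.realRoots ∨ hA.form c c = 0 := by
  by_cases h0 : R.latticeWeight c = 0
  · rw [← map_zero R.latticeWeight] at h0
    exact Or.inr (by simp [R.latticeWeight_injective h0])
  · obtain ⟨c', hc', h⟩ := R.exists_coordinates_of_mem_roots hA
      ⟨h0, (Submodule.ne_bot_iff _).2 ⟨z, hz, hz0⟩⟩
    rwa [← R.latticeWeight_injective hc'] at h

theorem form_pos_of_mem_realRoots (R : Realization A H) (hA : IsAffineCartan A) {a : ι → ℤ}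
    (ha : R.latticeWeight a ∈ R.realRoots) : 0 < hA.form a a := by
  obtain ⟨c, hc, hpos, -⟩ := R.exists_coordinates_of_mem_realRoots hA ha
  rwa [R.latticeWeight_injective hc]

theorem exists_pairing_eq (R : Realization A H) (hA : IsAffineCartan A) {a : ι → ℤ}
    (ha : R.latticeWeight a ∈ R.realRoots) (b : ι → ℤ) :
    ∃ n : ℤ, R.latticeWeight b (R.coroot (R.latticeWeight a)) = n ∧
      n * hA.form a a = 2 * hA.form a b := by
  obtain ⟨c, hc, -, h⟩ := R.exists_coordinates_of_mem_realRoots hA ha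
  obtain rfl := R.latticeWeight_injective hc
  exact h b

theorem pairing_eq_zero_iff (R : Realization A H) (hA : IsAffineCartan A) {a : ι → ℤ}
    (ha : R.latticeWeight a ∈ R.realRoots) (b : ι → ℤ) :
    R.latticeWeight b (R.coroot (R.latticeWeight a)) = 0 ↔ hA.form a b = 0 := by
  obtain ⟨n, hn, h⟩ := R.exists_pairing_eq hA ha b
  have hpos := R.form_pos_of_mem_realRoots hA ha
  rw [hn]
  constructor
  · intro h0
    rw [Int.cast_eq_zero.1 h0] at h
    simpa using h
  · intro h0
    rw [h0, mul_zero] at h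
    rw [Int.cast_eq_zero]
    exact_mod_cast (mul_eq_zero.1 h).resolve_right hpos.ne'

theorem reflect_latticeWeight (R : Realization A H) (hA : IsAffineCartan A) {a b : ι → ℤ}
    (ha : R.latticeWeight a ∈ R.realRoots) (hab : hA.form a b = hA.form a a) :
    R.reflect (R.latticeWeight a) (R.latticeWeight b) = R.latticeWeight (b - (2 : ℤ) • a) := by
  obtain ⟨n, hn, h⟩ := R.exists_pairing_eq hA ha b
  have hpos := R.form_pos_of_mem_realRoots hA ha
  rw [hab] at h
  have h2 : n = 2 := by exact_mod_cast mul_right_cancel₀ hpos.ne' h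
  rw [reflect, hn, h2, map_sub, map_smul, Int.cast_smul_eq_zsmul]

theorem exists_coordinates (R : Realization A H) (hA : IsAffineCartan A) {α : Module.Dual ℂ H}
    (hα : α ∈ R.realRoots) : ∃ c, α = R.latticeWeight c :=
  let ⟨c, hc, _⟩ := R.exists_coordinates_of_mem_realRoots hA hα
  ⟨c, hc⟩

theorem orthogonal_symm (R : Realization A H) (hA : IsAffineCartan A) {α β : Module.Dual ℂ H}
    (hα : α ∈ R.realRoots) (hβ : β ∈ R.realRoots) (h : β (R.coroot α) = 0) :
    α (R.coroot β) = 0 := by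
  obtain ⟨a, rfl⟩ := R.exists_coordinates hA hα
  obtain ⟨b, rfl⟩ := R.exists_coordinates hA hβ
  rw [R.pairing_eq_zero_iff hA hα] at h
  rw [R.pairing_eq_zero_iff hA hβ, hA.form_comm, h]

/-! ### Closed subroot systems -/

/-- A set of integers containing `0` and two coprime integers `a`, `b` and closed under the point
reflections in its elements contains `a + b`: it is stable under translation by `2`, and one of
`0`, `a`, `b` has the parity of `a + b`. -/
theorem _root_.AffineKM.add_mem_of_point_reflections {J : Set ℤ}
    (hJ : ∀ a ∈ J, ∀ b ∈ J, 2 * a - b ∈ J) (h0 : 0 ∈ J) {a b : ℤ} (ha : a ∈ J) (hb : b ∈ J)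
    (hab : IsCoprime a b) : a + b ∈ J := by
  have hneg : ∀ x ∈ J, -x ∈ J := fun x hx => by simpa using hJ 0 h0 x hx
  have htrans : ∀ t ∈ J, ∀ n : ℕ, ∀ x ∈ J, 2 * t * n + x ∈ J := by
    intro t ht n
    induction n with
    | zero => intro x hx; simpa using hx
    | succ n ih =>
      intro x hx
      have := hJ t ht _ (hneg _ (ih x hx))
      rwa [show 2 * t - -(2 * t * n + x) = 2 * t * ((n + 1 : ℕ) : ℤ) + x by push_cast; ring]
        at this
  have htransZ : ∀ t ∈ J, ∀ n : ℤ, ∀ x ∈ J, 2 * t * n + x ∈ J := by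
    intro t ht n x hx
    obtain ⟨m, rfl | rfl⟩ := n.eq_nat_or_neg
    · exact htrans t ht m x hx
    · have := htrans (-t) (hneg t ht) m x hx
      rwa [show 2 * t * -(m : ℤ) = 2 * (-t) * m by ring]
  obtain ⟨p, q, hpq⟩ := hab
  have htwo : ∀ n : ℤ, ∀ x ∈ J, 2 * n + x ∈ J := by
    intro n x hx
    have := htransZ a ha (p * n) _ (htransZ b hb (q * n) x hx)
    rwa [show 2 * a * (p * n) + (2 * b * (q * n) + x) = 2 * n + x by
      linear_combination 2 * n * hpq] at this
  rcases Int.even_or_odd a with ⟨s, hs⟩ | hao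
  · have := htwo s b hb
    rwa [show 2 * s + b = a + b by rw [hs]; ring] at this
  rcases Int.even_or_odd b with ⟨s, hs⟩ | hbo
  · have := htwo s a ha
    rwa [show 2 * s + a = a + b by rw [hs]; ring] at this
  · obtain ⟨s, hs⟩ := hao.add_odd hbo
    have := htwo s 0 h0
    rwa [show 2 * s + 0 = a + b by rw [hs]; ring] at this

namespace IsClosedSubroot

variable {R : Realization A H} {Ψ : Set (Module.Dual ℂ H)}

theorem neg_mem (hΨ : R.IsClosedSubroot Ψ) (hA : IsAffineCartan A) {a : ι → ℤ}
    (ha : R.latticeWeight a ∈ Ψ) : R.latticeWeight (-a) ∈ Ψ := by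
  have := hΨ.reflect_mem _ ha _ ha
  rwa [R.reflect_latticeWeight hA (hΨ.subset ha) rfl,
    show a - (2 : ℤ) • a = -a by module] at this

/-- Translating an element of `Ψ` by isotropic vectors: the multiples `j` of a primitive isotropic
vector for which `p + j δ ∈ Ψ` are closed under point reflections. -/
theorem translate_mem (hΨ : R.IsClosedSubroot Ψ) (hA : IsAffineCartan A) {p k m : ι → ℤ}
    (hk : hA.form k k = 0) (hm : hA.form m m = 0) (hp : R.latticeWeight p ∈ Ψ)
    (hpk : R.latticeWeight (-p + k) ∈ Ψ) (hpm : R.latticeWeight (-p + m) ∈ Ψ) :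
    R.latticeWeight (-p + m + k) ∈ Ψ := by
  obtain ⟨δ, a, b, hab, rfl, rfl⟩ := hA.exists_coprime_multiples hk hm
  have hδ : hA.form δ δ = 0 := by
    by_contra hδ
    simp only [map_smul, LinearMap.smul_apply, smul_eq_zero, hδ, or_false, or_self] at hk hm
    rw [hk, hm] at hab
    exact not_isCoprime_zero_zero hab
  have hform : ∀ x y : ℤ, hA.form (p + x • δ) (p + y • δ) = hA.form p p := by
    intro x y
    simp only [map_add, map_smul, LinearMap.add_apply, LinearMap.smul_apply,
      hA.form_isotropic_right hδ, hA.form_isotropic_left hδ, smul_zero, add_zero]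
  have hJ : ∀ x ∈ {j : ℤ | R.latticeWeight (p + j • δ) ∈ Ψ},
      ∀ y ∈ {j : ℤ | R.latticeWeight (p + j • δ) ∈ Ψ},
        2 * x - y ∈ {j : ℤ | R.latticeWeight (p + j • δ) ∈ Ψ} := by
    intro x hx y hy
    have := hΨ.reflect_mem _ hx _ hy
    rw [R.reflect_latticeWeight hA (hΨ.subset hx) (by rw [hform, hform])] at this
    have := hΨ.neg_mem hA this
    rwa [show -(p + y • δ - (2 : ℤ) • (p + x • δ)) = p + (2 * x - y) • δ by module] at this
  have hmem : ∀ x : ℤ, R.latticeWeight (-p + x • δ) ∈ Ψ →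
      -x ∈ {j : ℤ | R.latticeWeight (p + j • δ) ∈ Ψ} := by
    intro x hx
    have := hΨ.neg_mem hA hx
    rwa [show -(-p + x • δ) = p + (-x) • δ by module] at this
  have h := add_mem_of_point_reflections hJ (by simpa using hp) (hmem a hpk) (hmem b hpm)
    hab.neg_neg
  have := hΨ.neg_mem hA h
  rwa [show -(p + (-a + -b) • δ) = -p + b • δ + a • δ by module] at this

end IsClosedSubroot

/-- The generators of `g(Ψ)`, labelled by their weights. -/
def IsGenerator (R : Realization A H) (Ψ : Set (Module.Dual ℂ H)) (β : Module.Dual ℂ H)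
    (x : R.KM) : Prop := β ∈ Ψ ∧ x ∈ R.rootSpace β

theorem regularSubalgebra_eq (R : Realization A H) (Ψ : Set (Module.Dual ℂ H)) :
    R.regularSubalgebra Ψ = LieSubalgebra.lieSpan ℂ R.KM {x | ∃ β, R.IsGenerator Ψ β x} := by
  unfold regularSubalgebra
  congr 1
  ext x
  simp [IsGenerator]

section NestedBrackets

variable {R : Realization A H} {Ψ : Set (Module.Dual ℂ H)} {l : List (Module.Dual ℂ H)} {z : R.KM}

theorem _root_.AffineKM.NestedBracket.mem_rootSpace (hz : NestedBracket (R.IsGenerator Ψ) l z) :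
    z ∈ R.rootSpace l.sum := by
  induction hz with
  | single hx => simpa using hx.2
  | cons hx _ ih =>
    rw [List.sum_cons]
    exact lie_mem_weightSpace (h := R.kmGenerators.h) hx.2 ih

theorem _root_.AffineKM.NestedBracket.label_mem (hz : NestedBracket (R.IsGenerator Ψ) l z) :
    ∀ β ∈ l, β ∈ Ψ := by
  induction hz with
  | single hx => simpa using hx.1
  | cons hx _ ih =>
    rw [List.forall_mem_cons]
    exact ⟨hx.1, ih⟩

/-- Every root of `g(Ψ)` is the weight of a nonzero nested bracket of generators. -/
theorem exists_nestedBracket_of_mem_rootsOf {β : Module.Dual ℂ H}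
    (hβ : β ∈ R.rootsOf (R.regularSubalgebra Ψ)) :
    ∃ l z, NestedBracket (R.IsGenerator Ψ) l z ∧ z ≠ 0 ∧ l.sum = β := by
  obtain ⟨x, hx, hx0⟩ := (Submodule.ne_bot_iff _).1 hβ.2
  obtain ⟨hxβ, hxΨ⟩ := Submodule.mem_inf.1 hx
  rw [LieSubalgebra.mem_toSubmodule, regularSubalgebra_eq] at hxΨ
  obtain ⟨z, ⟨l, hl⟩, hz0, hz⟩ := exists_mem_weightSpace_of_mem_span R.kmGenerators.lie_h_h
    (S := {z | ∃ l, NestedBracket (R.IsGenerator Ψ) l z})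
    (fun s ⟨l, hl⟩ => ⟨l.sum, hl.mem_rootSpace⟩) hx0 hxβ (mem_span_nestedBracket hxΨ)
  exact ⟨l, z, hl, hz0, weight_unique (h := R.kmGenerators.h) hz0 hl.mem_rootSpace hz⟩

theorem exists_coordinates_sum (hA : IsAffineCartan A) (hl : ∀ β ∈ l, β ∈ R.realRoots) :
    ∃ c, l.sum = R.latticeWeight c := by
  induction l with
  | nil => exact ⟨0, by simp⟩
  | cons β l ih =>
    obtain ⟨b, hb⟩ := R.exists_coordinates hA (hl β (by simp))
    obtain ⟨c, hc⟩ := ih fun γ hγ => hl γ (List.mem_cons_of_mem _ hγ)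
    exact ⟨b + c, by rw [List.sum_cons, hb, hc, map_add]⟩

/-- Passing through an isotropic weight `p + q`: if a generator of weight `b` does not commute with
a root vector of weight `p`, then `b + p + q` belongs to `Ψ` as soon as it is a real root. -/
theorem IsClosedSubroot.add_add_mem (hΨ : R.IsClosedSubroot Ψ) (hA : IsAffineCartan A)
    {b p q : ι → ℤ} (hb : R.latticeWeight b ∈ Ψ) (hp : R.latticeWeight p ∈ Ψ)
    (hq : R.latticeWeight q ∈ Ψ) {x u : R.KM} (hx : x ∈ R.rootSpace (R.latticeWeight b))
    (hu : u ∈ R.rootSpace (R.latticeWeight p)) (hxu : ⁅x, u⁆ ≠ 0)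
    (hpq : hA.form (p + q) (p + q) = 0) (hbpq : R.latticeWeight (b + p + q) ∈ R.realRoots) :
    R.latticeWeight (b + p + q) ∈ Ψ := by
  have hw : ⁅x, u⁆ ∈ R.rootSpace (R.latticeWeight (b + p)) := by
    rw [map_add]
    exact lie_mem_weightSpace (h := R.kmGenerators.h) hx hu
  rcases R.mem_realRoots_or_isotropic hA hw hxu with h | h
  · have h1 : R.latticeWeight (b + p) ∈ Ψ := by
      rw [map_add] at h ⊢
      exact hΨ.closed _ hb _ hp h
    rw [map_add] at hbpq ⊢
    exact hΨ.closed _ h1 _ hq hbpq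
  · have := hΨ.translate_mem hA hpq h hp (by simpa using hq) (by simpa [add_comm b p] using hb)
    rwa [show -p + (b + p) + (p + q) = b + p + q by abel] at this

/-- If the weight of a nonzero nested bracket of generators of `g(Ψ)` is a real root, it belongs
to `Ψ`. The induction runs over a bound `n` of the number of generators, since it has to go back two
steps when the penultimate weight is isotropic. -/
theorem IsClosedSubroot.sum_mem (hΨ : R.IsClosedSubroot Ψ) (hA : IsAffineCartan A) (n : ℕ) :
    ∀ l (z : R.KM), l.length ≤ n → NestedBracket (R.IsGenerator Ψ) l z → z ≠ 0 →
      l.sum ∈ R.realRoots → l.sum ∈ Ψ := by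
  induction n with
  | zero =>
    intro l z hl hz
    cases hz <;> simp at hl
  | succ n ih =>
    intro l z hl hz hz0 hreal
    cases hz with
    | single hx => simpa using hx.1
    | @cons β x l' y hx hy =>
      have hlen : l'.length ≤ n := by simpa using hl
      have hy0 : y ≠ 0 := by rintro rfl; simp at hz0
      obtain ⟨b, rfl⟩ := R.exists_coordinates hA (hΨ.subset hx.1)
      obtain ⟨c, hc⟩ := exists_coordinates_sum hA fun γ hγ => hΨ.subset (hy.label_mem γ hγ)
      have hyc := hy.mem_rootSpace
      rw [hc] at hyc
      rw [List.sum_cons] at hreal ⊢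
      rcases R.mem_realRoots_or_isotropic hA hyc hy0 with h | h
      · exact hΨ.closed _ hx.1 _ (ih _ y hlen hy hy0 (hc ▸ h)) hreal
      cases hy with
      | @single γ _ hy =>
        have hγ := hΨ.subset hy.1
        rw [show γ = R.latticeWeight c by simpa using hc] at hγ
        exact absurd h (R.form_pos_of_mem_realRoots hA hγ).ne'
      | @cons γ u l'' v hu hv =>
        have hv0 : v ≠ 0 := by rintro rfl; simp at hy0
        obtain ⟨p, rfl⟩ := R.exists_coordinates hA (hΨ.subset hu.1)
        obtain ⟨q, hq⟩ := exists_coordinates_sum hA fun γ hγ => hΨ.subset (hv.label_mem γ hγ)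
        have hvq := hv.mem_rootSpace
        rw [hq] at hvq
        have hcpq : c = p + q := by
          apply R.latticeWeight_injective
          rw [← hc, List.sum_cons, hq, map_add]
        subst hcpq
        -- `q` is the difference of an isotropic vector and `p`, hence not isotropic.
        have hqq : hA.form q q = hA.form p p := by
          have h1 := hA.form_isotropic_left h p
          have h2 := hA.form_isotropic_left h q
          simp only [map_add, LinearMap.add_apply] at h1 h2
          rw [hA.form_comm q p] at h1
          linarith
        have hqΨ : R.latticeWeight q ∈ Ψ := by
          rcases R.mem_realRoots_or_isotropic hA hvq hv0 with h' | h'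
          · rw [← hq] at h' ⊢
            exact ih _ v (by simp at hlen; omega) hv hv0 h'
          · rw [hqq] at h'
            exact absurd h' (R.form_pos_of_mem_realRoots hA (hΨ.subset hu.1)).ne'
        rw [hc, ← map_add, ← add_assoc] at hreal ⊢
        rw [leibniz_lie] at hz0
        by_cases hxu : ⁅x, u⁆ = 0
        · have hxv : ⁅x, v⁆ ≠ 0 := by
            intro h0
            rw [hxu, h0] at hz0
            simp at hz0
          rw [add_right_comm] at hreal ⊢
          exact hΨ.add_add_mem hA hx.1 hqΨ hu.1 hx.2 hvq hxv (by rwa [add_comm]) hreal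
        · exact hΨ.add_add_mem hA hx.1 hu.1 hqΨ hx.2 hu.2 hxu h hreal

end NestedBrackets

/-! ### Irreducible components -/

section Components

variable {R : Realization A H} {Ψ C : Set (Module.Dual ℂ H)}

/-- Two elements of `Ψ` are linked if they are not orthogonal. -/
def Linked (R : Realization A H) (Ψ : Set (Module.Dual ℂ H)) (α β : Module.Dual ℂ H) : Prop :=
  α ∈ Ψ ∧ β ∈ Ψ ∧ β (R.coroot α) ≠ 0

/-- Every element of `Ψ` belongs to an irreducible component: its connected component for the
relation of being non-orthogonal. -/
theorem IsClosedSubroot.exists_isComponent (hΨ : R.IsClosedSubroot Ψ) (hA : IsAffineCartan A)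
    {α : Module.Dual ℂ H} (hα : α ∈ Ψ) : ∃ C, R.IsComponent Ψ C ∧ α ∈ C := by
  set C := {β | Relation.ReflTransGen (R.Linked Ψ) α β} with hC
  have hCΨ : C ⊆ Ψ := by
    intro β hβ
    rcases Relation.ReflTransGen.cases_tail hβ with rfl | ⟨γ, -, h⟩
    · exact hα
    · exact h.2.1
  have hαC : α ∈ C := Relation.ReflTransGen.refl
  -- A path from `α` to a point outside a set containing `α` has to leave this set.
  have hcross : ∀ D : Set (Module.Dual ℂ H), α ∈ D → (∃ γ ∈ C, γ ∉ D) →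
      ∃ β ∈ C, β ∈ D ∧ ∃ γ ∈ C, γ ∉ D ∧ γ (R.coroot β) ≠ 0 := by
    rintro D hD ⟨γ, hγC, hγD⟩
    by_contra! hcon
    refine hγD ?_
    clear hγD
    induction hγC with
    | refl => exact hD
    | @tail β γ hβ hβγ ih =>
      by_contra hγD
      exact hβγ.2.2 (hcon β hβ ih γ (hβ.tail hβγ) hγD)
  refine ⟨C, ⟨hCΨ, ⟨⟨α, hαC⟩, ?_⟩, ?_⟩, hαC⟩
  · rintro D hDC ⟨δ, hδ⟩ ⟨γ, hγC, hγD⟩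
    by_cases hαD : α ∈ D
    · obtain ⟨β, -, hβD, γ, hγC, hγD, h⟩ := hcross D hαD ⟨γ, hγC, hγD⟩
      exact ⟨β, hβD, γ, ⟨hγC, hγD⟩, h⟩
    · obtain ⟨β, hβC, hβD, γ, hγC, hγD, h⟩ := hcross Dᶜ hαD ⟨δ, hDC hδ, not_not.2 hδ⟩
      exact ⟨γ, not_not.1 hγD, β, ⟨hβC, hβD⟩, fun h0 => h
        (R.orthogonal_symm hA (hΨ.subset (hCΨ hγC)) (hΨ.subset (hCΨ hβC)) h0)⟩
  · rintro β hβ γ ⟨hγΨ, hγC⟩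
    by_contra h
    exact hγC (Relation.ReflTransGen.tail hβ ⟨hCΨ hβ, hγΨ, h⟩)

/-- Root vectors attached to different components commute: the sum of two orthogonal real roots has
positive norm, and if it were in `Ψ` it would link both components. -/
theorem IsClosedSubroot.lie_eq_zero (hΨ : R.IsClosedSubroot Ψ) (hA : IsAffineCartan A)
    (hC : R.IsComponent Ψ C) {α β : Module.Dual ℂ H} (hα : α ∈ C) (hβ : β ∈ Ψ) (hβC : β ∉ C)
    {x y : R.KM} (hx : x ∈ R.rootSpace α) (hy : y ∈ R.rootSpace β) : ⁅y, x⁆ = 0 := by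
  by_contra h0
  have hαΨ := hC.1 hα
  have horth := hC.2.2 α hα β ⟨hβ, hβC⟩
  obtain ⟨a, rfl⟩ := R.exists_coordinates hA (hΨ.subset hαΨ)
  obtain ⟨b, rfl⟩ := R.exists_coordinates hA (hΨ.subset hβ)
  have ha := R.form_pos_of_mem_realRoots hA (hΨ.subset hαΨ)
  have hb := R.form_pos_of_mem_realRoots hA (hΨ.subset hβ)
  rw [R.pairing_eq_zero_iff hA (hΨ.subset hαΨ)] at horth
  have hw : ⁅y, x⁆ ∈ R.rootSpace (R.latticeWeight (b + a)) := by
    rw [map_add]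
    exact lie_mem_weightSpace (h := R.kmGenerators.h) hy hx
  rcases R.mem_realRoots_or_isotropic hA hw h0 with h | h
  · have hΨ' : R.latticeWeight (b + a) ∈ Ψ := by
      rw [map_add] at h ⊢
      exact hΨ.closed _ hβ _ hαΨ h
    by_cases hC' : R.latticeWeight (b + a) ∈ C
    · have := hC.2.2 _ hC' _ ⟨hβ, hβC⟩
      rw [R.pairing_eq_zero_iff hA h, map_add, LinearMap.add_apply, horth] at this
      linarith
    · have := hC.2.2 _ hα _ ⟨hΨ', hC'⟩
      rw [R.pairing_eq_zero_iff hA (hΨ.subset hαΨ), map_add, horth] at this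
      linarith
  · simp only [map_add, LinearMap.add_apply, hA.form_comm b a, horth] at h
    linarith

/-- The labels of a nonzero nested bracket belong to one component. -/
theorem IsClosedSubroot.exists_isComponent_of_nestedBracket (hΨ : R.IsClosedSubroot Ψ)
    (hA : IsAffineCartan A) {l : List (Module.Dual ℂ H)} {z : R.KM}
    (hz : NestedBracket (R.IsGenerator Ψ) l z) (hz0 : z ≠ 0) :
    ∃ C, R.IsComponent Ψ C ∧ ∀ β ∈ l, β ∈ C := by
  induction hz with
  | single hx =>
    obtain ⟨C, hC, h⟩ := hΨ.exists_isComponent hA hx.1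
    exact ⟨C, hC, by simpa using h⟩
  | @cons β x l y hx hy ih =>
    obtain ⟨C, hC, hl⟩ := ih (by rintro rfl; simp at hz0)
    refine ⟨C, hC, ?_⟩
    suffices hβ : β ∈ C by simpa using ⟨hβ, hl⟩
    by_contra hβ
    refine hz0 ?_
    clear hz0 ih
    induction hy with
    | single hy => exact hΨ.lie_eq_zero hA hC (hl _ (by simp)) hx.1 hβ hy.2 hx.2
    | cons hy _ ih =>
      rw [leibniz_lie, ih fun γ hγ => hl γ (List.mem_cons_of_mem _ hγ),
        hΨ.lie_eq_zero hA hC (hl _ (by simp)) hx.1 hβ hy.2 hx.2, zero_lie, lie_zero, add_zero]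

/-- An element of `Ψ` which is a sum of elements of a component belongs to this component: having
positive norm it is not orthogonal to all the summands. -/
theorem IsClosedSubroot.sum_mem_component (hΨ : R.IsClosedSubroot Ψ) (hA : IsAffineCartan A)
    (hC : R.IsComponent Ψ C) {l : List (Module.Dual ℂ H)} (hl : ∀ β ∈ l, β ∈ C)
    (hsum : l.sum ∈ Ψ) : l.sum ∈ C := by
  by_contra hnot
  obtain ⟨c, hc⟩ := R.exists_coordinates hA (hΨ.subset hsum)
  have horth : ∀ l' : List (Module.Dual ℂ H), (∀ β ∈ l', β ∈ C) →
      ∃ s, l'.sum = R.latticeWeight s ∧ hA.form s c = 0 := by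
    intro l' hl'
    induction l' with
    | nil => exact ⟨0, by simp, by simp⟩
    | cons β l' ih =>
      obtain ⟨s, hs, hsc⟩ := ih fun γ hγ => hl' γ (List.mem_cons_of_mem _ hγ)
      have hβ := hl' β (by simp)
      have h0 := hC.2.2 β hβ _ ⟨hsum, hnot⟩
      obtain ⟨b, rfl⟩ := R.exists_coordinates hA (hΨ.subset (hC.1 hβ))
      rw [hc, R.pairing_eq_zero_iff hA (hΨ.subset (hC.1 hβ))] at h0
      exact ⟨b + s, by rw [List.sum_cons, hs, map_add], by simp [h0, hsc]⟩
  obtain ⟨s, hs, hsc⟩ := horth l hl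
  obtain rfl := R.latticeWeight_injective (hs.symm.trans hc)
  exact (R.form_pos_of_mem_realRoots hA (hc ▸ hΨ.subset hsum)).ne' hsc

theorem mem_rootsOf_of_nestedBracket {l : List (Module.Dual ℂ H)} {z : R.KM}
    (hz : NestedBracket (R.IsGenerator Ψ) l z) (hz0 : z ≠ 0) (hsum : l.sum ≠ 0) :
    l.sum ∈ R.rootsOf (R.regularSubalgebra Ψ) := by
  refine ⟨⟨hsum, (Submodule.ne_bot_iff _).2 ⟨z, hz.mem_rootSpace, hz0⟩⟩,
    (Submodule.ne_bot_iff _).2 ⟨z, Submodule.mem_inf.2 ⟨hz.mem_rootSpace, ?_⟩, hz0⟩⟩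
  rw [LieSubalgebra.mem_toSubmodule, regularSubalgebra_eq]
  exact hz.mem_lieSpan

/-- `β` is the sum of a sequence in `C` all of whose partial sums are roots of `g(Ψ)` and belong to
`C` as soon as they are real. -/
def IsReachable (R : Realization A H) (Ψ C : Set (Module.Dual ℂ H)) (β : Module.Dual ℂ H) : Prop :=
  ∃ (r : ℕ) (b : ℕ → Module.Dual ℂ H), (∀ i ∈ Finset.Icc 1 r, b i ∈ C) ∧
    β = ∑ j ∈ Finset.Icc 1 r, b j ∧
    (∀ i ∈ Finset.Icc 1 r, ∑ j ∈ Finset.Icc 1 i, b j ∈ R.rootsOf (R.regularSubalgebra Ψ)) ∧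
    (∀ i ∈ Finset.Icc 1 r,
      ∑ j ∈ Finset.Icc 1 i, b j ∈ R.realRoots → ∑ j ∈ Finset.Icc 1 i, b j ∈ C)

theorem IsReachable.of_mem {β : Module.Dual ℂ H} (hβ : β ∈ C)
    (hroot : β ∈ R.rootsOf (R.regularSubalgebra Ψ)) : R.IsReachable Ψ C β :=
  ⟨1, fun _ => β, by simpa using hβ, by simp, by simpa using hroot, by simpa using fun _ => hβ⟩

theorem IsReachable.add {β γ : Module.Dual ℂ H} (hγ : R.IsReachable Ψ C γ) (hβ : β ∈ C)
    (hroot : β + γ ∈ R.rootsOf (R.regularSubalgebra Ψ))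
    (hreal : β + γ ∈ R.realRoots → β + γ ∈ C) : R.IsReachable Ψ C (β + γ) := by
  obtain ⟨r, b, hb, hsum, hroots, hreals⟩ := hγ
  set b' := Function.update b (r + 1) β with hb'
  have hlow : ∀ i ≤ r, b' i = b i := fun i hi => Function.update_of_ne (by omega) _ _
  have hlast : b' (r + 1) = β := Function.update_self _ _ _
  have hpart : ∀ i ≤ r, ∑ j ∈ Finset.Icc 1 i, b' j = ∑ j ∈ Finset.Icc 1 i, b j := fun i hi =>
    Finset.sum_congr rfl fun j hj => hlow j ((Finset.mem_Icc.1 hj).2.trans hi)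
  have htotal : ∑ j ∈ Finset.Icc 1 (r + 1), b' j = β + γ := by
    rw [Finset.sum_Icc_succ_top (by omega), hpart r le_rfl, hlast, ← hsum, add_comm]
  have hsplit : ∀ P : ℕ → Prop, (∀ i ∈ Finset.Icc 1 r, P i) → P (r + 1) →
      ∀ i ∈ Finset.Icc 1 (r + 1), P i := by
    intro P h1 h2 i hi
    rcases Nat.lt_or_ge r i with h | h
    · obtain rfl : i = r + 1 := by have := (Finset.mem_Icc.1 hi).2; omega
      exact h2
    · exact h1 i (Finset.mem_Icc.2 ⟨(Finset.mem_Icc.1 hi).1, h⟩)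
  refine ⟨r + 1, b', hsplit _ (fun i hi => ?_) ?_, htotal.symm, hsplit _ (fun i hi => ?_) ?_,
    hsplit _ (fun i hi => ?_) ?_⟩
  · rw [hlow i (Finset.mem_Icc.1 hi).2]; exact hb i hi
  · rw [hlast]; exact hβ
  · rw [hpart i (Finset.mem_Icc.1 hi).2]; exact hroots i hi
  · rw [htotal]; exact hroot
  · rw [hpart i (Finset.mem_Icc.1 hi).2]; exact hreals i hi
  · rw [htotal]; exact hreal

/-- The weight of a nonzero nested bracket is reachable: the sequence of its labels, restarted
after each partial sum which is zero, has all the required properties. -/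
theorem IsClosedSubroot.isReachable_sum (hΨ : R.IsClosedSubroot Ψ) (hA : IsAffineCartan A)
    (hC : R.IsComponent Ψ C) {l : List (Module.Dual ℂ H)} {z : R.KM}
    (hz : NestedBracket (R.IsGenerator Ψ) l z) (hz0 : z ≠ 0) (hl : ∀ β ∈ l, β ∈ C)
    (hsum : l.sum ≠ 0) : R.IsReachable Ψ C l.sum := by
  induction hz with
  | @single β x hx =>
    have hroot := mem_rootsOf_of_nestedBracket (.single hx) hz0 hsum
    rw [List.sum_singleton] at hroot ⊢
    exact .of_mem (hl β (by simp)) hroot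
  | @cons β x l y hx hy ih =>
    have hroot := mem_rootsOf_of_nestedBracket (.cons hx hy) hz0 hsum
    have hreal : (β :: l).sum ∈ R.realRoots → (β :: l).sum ∈ C := fun h =>
      hΨ.sum_mem_component hA hC hl (hΨ.sum_mem hA _ _ _ le_rfl (.cons hx hy) hz0 h)
    rw [List.sum_cons] at hroot hreal ⊢
    have hβ : β ∈ C := hl β (by simp)
    by_cases h0 : l.sum = 0
    · rw [h0, add_zero] at hroot ⊢
      exact .of_mem hβ hroot
    · have hy0 : y ≠ 0 := by rintro rfl; simp at hz0
      exact (ih hy0 (fun γ hγ => hl γ (List.mem_cons_of_mem _ hγ)) h0).add hβ hroot hreal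

theorem IsClosedSubroot.rootsOf_inter_realRoots (hΨ : R.IsClosedSubroot Ψ)
    (hA : IsAffineCartan A) : R.rootsOf (R.regularSubalgebra Ψ) ∩ R.realRoots = Ψ := by
  apply Set.Subset.antisymm
  · rintro β ⟨hβ, hreal⟩
    obtain ⟨l, z, hz, hz0, rfl⟩ := exists_nestedBracket_of_mem_rootsOf hβ
    exact hΨ.sum_mem hA _ l z le_rfl hz hz0 hreal
  · intro β hβ
    have hreal := hΨ.subset hβ
    obtain ⟨x, hx, hx0⟩ := (Submodule.ne_bot_iff _).1 hreal.1.2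
    have := mem_rootsOf_of_nestedBracket (R := R) (Ψ := Ψ) (.single ⟨hβ, hx⟩) hx0
      (by simpa using hreal.1.1)
    exact ⟨by simpa using this, hreal⟩

end Components

end Realization

end AffineKM

end

theorem mainTheorem10 {ι : Type*} [Fintype ι] {A : Matrix ι ι ℤ}
    (hA : AffineKM.IsAffineCartan A) {H : Type*} [AddCommGroup H] [Module ℂ H]
    (R : AffineKM.Realization A H) :
    -- every root of `g(Ψ)` is a sum of elements of one irreducible component `C` of `Ψ`, all
    -- partial sums are roots of `g(Ψ)`, and those that are real lie in `C`
    (∀ Ψ : Set (Module.Dual ℂ H), R.IsClosedSubroot Ψ →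
      ∀ β ∈ R.rootsOf (R.regularSubalgebra Ψ),
        ∃ (r : ℕ) (b : ℕ → Module.Dual ℂ H) (C : Set (Module.Dual ℂ H)),
          R.IsComponent Ψ C ∧
          (∀ i ∈ Finset.Icc 1 r, b i ∈ C) ∧
          β = ∑ j ∈ Finset.Icc 1 r, b j ∧
          (∀ i ∈ Finset.Icc 1 r,
            ∑ j ∈ Finset.Icc 1 i, b j ∈ R.rootsOf (R.regularSubalgebra Ψ)) ∧
          (∀ i ∈ Finset.Icc 1 r,
            ∑ j ∈ Finset.Icc 1 i, b j ∈ R.realRoots → ∑ j ∈ Finset.Icc 1 i, b j ∈ C)) ∧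
    -- the real roots of `g(Ψ)` are exactly the elements of `Ψ`
    (∀ Ψ : Set (Module.Dual ℂ H), R.IsClosedSubroot Ψ →
      R.rootsOf (R.regularSubalgebra Ψ) ∩ R.realRoots = Ψ) ∧
    -- the correspondence between closed subroot systems and regular subalgebras
    Set.BijOn R.regularSubalgebra {Ψ | R.IsClosedSubroot Ψ} {g' | R.IsRegularSubalgebra g'} := by
  refine ⟨fun Ψ hΨ β hβ => ?_, fun Ψ hΨ => hΨ.rootsOf_inter_realRoots hA,
    fun Ψ hΨ => ⟨Ψ, hΨ, rfl⟩, fun Ψ hΨ Ψ' hΨ' h => ?_, fun g' ⟨Ψ, hΨ, h⟩ => ⟨Ψ, hΨ, h.symm⟩⟩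
  · obtain ⟨l, z, hz, hz0, rfl⟩ := AffineKM.Realization.exists_nestedBracket_of_mem_rootsOf hβ
    obtain ⟨C, hC, hl⟩ := hΨ.exists_isComponent_of_nestedBracket hA hz hz0
    obtain ⟨r, b, hb⟩ := hΨ.isReachable_sum hA hC hz hz0 hl hβ.1.1
    exact ⟨r, b, C, hC, hb⟩
  · have h1 := hΨ.rootsOf_inter_realRoots hA
    have h2 := hΨ'.rootsOf_inter_realRoots hA
    rw [← h1, ← h2]
    simp only [h]
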